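/- **Setting.** Fix an even integer $p\ge 2$. A $p$-regular trace map $\mathfrak b=(\pi,\alpha)$ is a combinatorial map all of whose vertices have degree $p$: the half-edges at each vertex are numbered $1,\dots,p$, $\pi$ rotates the half-edges around each vertex, and $\alpha$ is a fixed-point-free involution of the half-edges whose $2$-cycles are the edges. Let $\gamma(\mathfrak b)$ be its number of connected components. On maps with the same vertices (same $\pi$), let $\mathfrak b'\le\mathfrak b$ if $\mathfrak b'$ is obtained from $\mathfrak b$ by successive switches (a switch exchanges end points of two edges), each of which increases $\gamma$ by one. Let $\mathcal B_n$ be the finite set of isomorphism classes of connected $p$-regular trace maps with $n\ge1$ vertices and a distinguished half-edge (root). Let $E$ be a real vector space whose elements are regarded as tensors of order $p$ through a joint distribution: for every $p$-regular trace map $\mathfrak b$ with vertex set $V$ a multilinear form $(T_v)_{v\in V}\mapsto \mathfrak b((T_v)_{v})\in\mathbb R$ on $E^V$, independent of the names of the vertices, multiplicative over disjoint unions, and equal to $1$ for the empty map. For instance $E=(\mathbb R^N)^{\otimes p}$ with $\mathfrak b((T_v)_v)=N^{-\gamma(\mathfrak b)}\sum_{i}\prod_{v}(T_v)_{i_{\partial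 v}}$, where $i$ runs over the assignments of an index in $\{1,\dots,N\}$ to each edge, or a limit of such distributions. The free cumulants $\kappa_{\mathfrak b}$ are determined by $\mathfrak b((T_v)_v)=\sum_{\mathfrak b'\le\mathfrak b}\kappa_{\mathfrak b'}((T_v)_v)$. A family $(T_i)_{i\ge1}$ in $E$ is freely independent if its mixed free cumulants vanish, i.e. $\kappa_{\mathfrak b}((T_{c(v)})_v)=0$ for every connected $\mathfrak b$ and every non-constant $c:V\to\{1,2,\dots\}$. For $\mathfrak b\in\mathcal B_n$ write $\mathfrak b(T)=\mathfrak b(T,\dots,T)$ (if $T$ is not invariant under rotation of its legs, this is averaged over the labellings of $\mathfrak b$), and put $m_0(T)=1$, $m_n(T)=\sum_{\mathfrak b\in\mathcal B_n}\mathfrak b(T)$ for $n\ge1$. **Theorem (Free CLT).** Let $(T_i)_{i\ge1}$ be a freely independent family in $E$ such that $m_1(T_i)=0$ and $m_2(T_i)=1$ for all $i$, and such that for every $\mathfrak b\in\bigcup_{n\ge1}\mathcal B_n$ there is a constant $C(\mathfrak b)$ with $|\mathfrak b(T_i)|\le C(\mathfrak b)$ for all $i$. Put $T^k=\frac1{\sqrt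 k}\sum_{i=1}^kT_i$. Then for every $n\ge0$ $$\lim_{k\to\infty} m_n(T^k)=\int_{\mathbb R}\lambda^n\,d\mu_p(\lambda),$$ where $\mu_p$ is the high order semicircular law of order $p$, i.e. the compactly supported probability measure on $\mathbb R$ (which exists) with odd moments $0$ and moments $\int\lambda^{2k}\,d\mu_p(\lambda)=\frac1{pk+1}\binom{pk+1}{k}$ for all $k\ge0$. -/

import Mathlib

open Filter Topology MeasureTheory

/-- A `p`-regular trace map with vertex set `V`: a combinatorial map `(π, α)` without boundary all
of whose vertices have degree `p`. The half-edges are the pairs `(v, j)` with `v : V`, `j : Fin p`;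
those at `v` are ordered by `j`, the permutation `π` is the rotation `TraceMap.rot` below, and the
edges are the cycles of the fixed-point-free involution `α`. -/
@[ext]
structure TraceMap (p : ℕ) (V : Type) where
  α : Equiv.Perm (V × Fin p)
  invol : ∀ h, α (α h) = h
  no_fixed : ∀ h, α h ≠ h

namespace TraceMap

variable {p : ℕ} {V W : Type}

/-- The permutation `π`, whose cycles are the vertices. -/
def rot (p : ℕ) (V : Type) : Equiv.Perm (V × Fin p) :=
  Equiv.prodCongr (Equiv.refl V) (finRotate p)

instance [Finite V] : Finite (TraceMap p V) :=
  Finite.of_injective (fun b => b.α) (fun _ _ h => TraceMap.ext h)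

noncomputable instance [Finite V] : Fintype (TraceMap p V) := Fintype.ofFinite _

/-- The underlying graph, with loops and multiplicities forgotten. -/
def graph (b : TraceMap p V) : SimpleGraph V :=
  SimpleGraph.fromRel (fun v w => ∃ i j, b.α (v, i) = (w, j))

/-- The map is connected (in particular it has a vertex). -/
def Connected (b : TraceMap p V) : Prop := b.graph.Connected

/-- The number `γ` of connected components. -/
noncomputable def numComponents (b : TraceMap p V) : ℕ := Nat.card b.graph.ConnectedComponent

open Classical in
/-- `b'` arises from `b` by one switch (the end points `x` and `y` of two edges are exchanged)
and has one more connected component. -/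
def SwitchBelow (b b' : TraceMap p V) : Prop :=
  (∃ x y : V × Fin p, ∀ h, b'.α (Equiv.swap x y h) = Equiv.swap x y (b.α h)) ∧
    b'.numComponents = b.numComponents + 1

theorem numComponents_le {b b' : TraceMap p V} (h : Relation.ReflTransGen SwitchBelow b b') :
    b = b' ∨ b.numComponents < b'.numComponents := by
  induction h with
  | refl => exact Or.inl rfl
  | tail _ hs ih =>
    have := hs.2
    rcases ih with rfl | h
    · right; omega
    · right; omega

/-- The non-crossing poset on the trace maps with given vertices: `b' ≤ b` if `b'` is obtained from
`b` by successive switches each of which creates a connected component. -/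
instance : PartialOrder (TraceMap p V) where
  le b' b := Relation.ReflTransGen SwitchBelow b b'
  le_refl _ := Relation.ReflTransGen.refl
  le_trans _ _ _ h₁ h₂ := Relation.ReflTransGen.trans h₂ h₁
  le_antisymm b b' h₁ h₂ := by
    rcases numComponents_le h₁ with h | h
    · exact h.symm
    · rcases numComponents_le h₂ with h' | h'
      · exact h'
      · omega

/-- Renaming of the vertices. -/
def relabel (b : TraceMap p V) (e : V ≃ W) : TraceMap p W where
  α := (Equiv.prodCongr e (Equiv.refl (Fin p))).permCongr b.α
  invol h := by
    rw [Equiv.permCongr_apply, Equiv.permCongr_apply, Equiv.symm_apply_apply, b.invol,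
      Equiv.apply_symm_apply]
  no_fixed h := by
    intro hh
    rw [Equiv.permCongr_apply, ← Equiv.eq_symm_apply] at hh
    exact b.no_fixed _ hh

/-- Disjoint union. -/
def disjUnion (b : TraceMap p V) (c : TraceMap p W) : TraceMap p (V ⊕ W) where
  α := (Equiv.sumProdDistrib V W (Fin p)).symm.permCongr (Equiv.sumCongr b.α c.α)
  invol := by
    rintro ⟨v | w, j⟩ <;> simp [Equiv.permCongr_apply, b.invol, c.invol]
  no_fixed := by
    rintro ⟨v | w, j⟩ hh
    · rw [Equiv.permCongr_apply, ← Equiv.eq_symm_apply] at hh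
      simp only [Equiv.symm_symm, Equiv.sumProdDistrib_apply_left, Equiv.sumCongr_apply,
        Sum.map_inl, Sum.inl.injEq] at hh
      exact b.no_fixed _ hh
    · rw [Equiv.permCongr_apply, ← Equiv.eq_symm_apply] at hh
      simp only [Equiv.symm_symm, Equiv.sumProdDistrib_apply_right, Equiv.sumCongr_apply,
        Sum.map_inr, Sum.inr.injEq] at hh
      exact c.no_fixed _ hh

end TraceMap

/-- A connected trace map on the vertices `0, …, n - 1` with a distinguished half-edge. -/
structure LabelledRootedMap (p n : ℕ) where
  map : TraceMap p (Fin n)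
  connected : map.Connected
  root : Fin n × Fin p

namespace LabelledRootedMap

variable {p n : ℕ}

instance : Finite (LabelledRootedMap p n) :=
  Finite.of_injective (fun x => (x.map, x.root)) (by
    rintro ⟨b, hb, r⟩ ⟨b', hb', r'⟩ h
    simp only [Prod.mk.injEq] at h
    obtain ⟨rfl, rfl⟩ := h
    rfl)

noncomputable instance : Fintype (LabelledRootedMap p n) := Fintype.ofFinite _

/-- Isomorphism of rooted combinatorial maps: a bijection of the half-edges that respects `π`,
`α` and the root. -/
instance isoSetoid (p n : ℕ) : Setoid (LabelledRootedMap p n) where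
  r x y := ∃ σ : Equiv.Perm (Fin n × Fin p),
    (∀ h, σ (TraceMap.rot p (Fin n) h) = TraceMap.rot p (Fin n) (σ h)) ∧
    (∀ h, σ (x.map.α h) = y.map.α (σ h)) ∧ σ x.root = y.root
  iseqv :=
    { refl := fun _ => ⟨Equiv.refl _, fun _ => rfl, fun _ => rfl, rfl⟩
      symm := by
        rintro x y ⟨σ, h₁, h₂, h₃⟩
        refine ⟨σ.symm, fun h => ?_, fun h => ?_, ?_⟩
        · rw [Equiv.symm_apply_eq, h₁, Equiv.apply_symm_apply]
        · rw [Equiv.symm_apply_eq, h₂, Equiv.apply_symm_apply]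
        · rw [Equiv.symm_apply_eq, h₃]
      trans := by
        rintro x y z ⟨σ, h₁, h₂, h₃⟩ ⟨τ, k₁, k₂, k₃⟩
        refine ⟨σ.trans τ, fun h => ?_, fun h => ?_, ?_⟩
        · simp only [Equiv.trans_apply, h₁, k₁]
        · simp only [Equiv.trans_apply, h₂, k₂]
        · simp only [Equiv.trans_apply, h₃, k₃] }

end LabelledRootedMap

/-- The set `𝓑ₙ` of connected rooted `p`-regular trace maps with `n` unlabelled vertices. -/
abbrev RootedMap (p n : ℕ) : Type := Quotient (LabelledRootedMap.isoSetoid p n)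

noncomputable instance (p n : ℕ) : Fintype (RootedMap p n) := Fintype.ofFinite _

/-- A joint distribution of the tensors of order `p` in a real vector space `E`: the values
`b((T_v)_v)` of the trace invariants of all `p`-regular trace maps `b` decorated with elements of
`E`. They are multilinear, do not depend on the names of the vertices, are multiplicative over
disjoint unions (the morphism property) and the empty map has value `1`.
`TensorDistribution.real` is the distribution of actual tensors; limits of joint distributions of
tensors, as the dimension of the legs grows, are other examples. -/
structure TensorDistribution (p : ℕ) (E : Type*) [AddCommGroup E] [Module ℝ E] where
  val : ∀ {V : Type} [Finite V], TraceMap p V → MultilinearMap ℝ (fun _ : V => E) ℝ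
  val_relabel : ∀ {V W : Type} [Finite V] [Finite W] (b : TraceMap p V) (e : V ≃ W) (T : W → E),
    val (b.relabel e) T = val b (fun v => T (e v))
  val_disjUnion : ∀ {V W : Type} [Finite V] [Finite W] (b : TraceMap p V) (c : TraceMap p W)
    (T : V ⊕ W → E),
    val (b.disjUnion c) T = val b (fun v => T (Sum.inl v)) * val c (fun w => T (Sum.inr w))
  val_empty : ∀ {V : Type} [Finite V] [IsEmpty V] (b : TraceMap p V) (T : V → E), val b T = 1

namespace TensorDistribution

variable {p : ℕ} {E : Type*} [AddCommGroup E] [Module ℝ E]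

open Classical in
/-- The free cumulant `κ_b((T_v)_v)`, defined by Möbius inversion, that is recursively from
`b((T_v)_v) = ∑_{b' ≤ b} κ_{b'}((T_v)_v)`. -/
noncomputable def cumulant (φ : TensorDistribution p E) {V : Type} [Finite V] (T : V → E)
    (b : TraceMap p V) : ℝ :=
  φ.val b T - ∑ b' : {b' : TraceMap p V // b' < b}, φ.cumulant T b'.1
termination_by (Finset.univ.filter (fun b' : TraceMap p V => b' < b)).card
decreasing_by
  apply Finset.card_lt_card
  rw [Finset.ssubset_iff_of_subset]
  · exact ⟨b'.1, by simpa using b'.2, by simp⟩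
  · intro c hc
    simp only [Finset.mem_filter, Finset.mem_univ, true_and] at hc ⊢
    exact hc.trans b'.2

open Classical in
/-- The moment-cumulant formula, which characterizes the free cumulants. -/
theorem val_eq_sum_cumulant (φ : TensorDistribution p E) {V : Type} [Finite V] (T : V → E)
    (b : TraceMap p V) :
    φ.val b T = ∑ b' : TraceMap p V with b' ≤ b, φ.cumulant T b' := by
  have h : (Finset.univ.filter (fun b' : TraceMap p V => b' ≤ b)) =
      insert b (Finset.univ.filter (fun b' : TraceMap p V => b' < b)) := by
    ext c
    simp [le_iff_eq_or_lt]
  rw [h, Finset.sum_insert (by simp), cumulant,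
    Finset.sum_subtype (Finset.univ.filter (fun b' : TraceMap p V => b' < b))
      (p := fun b' => b' < b) (by simp)]
  ring

/-- Free independence of a family of tensors of the same even order: all mixed free cumulants
vanish. -/
def FreelyIndependent (φ : TensorDistribution p E) {ι : Type*} (T : ι → E) : Prop :=
  ∀ (n : ℕ) (b : TraceMap p (Fin n)), b.Connected → ∀ c : Fin n → ι, (∃ v w, c v ≠ c w) →
    φ.cumulant (fun v => T (c v)) b = 0

open Classical in
/-- The value `b(T) = b(T, …, T)` for `b ∈ 𝓑ₙ`. If `T` is invariant under rotations of its legs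
(in particular, if it is symmetric) all labellings of `b` give the same number; in general it is
averaged over the labellings of `b`. -/
noncomputable def rootedVal (φ : TensorDistribution p E) {n : ℕ} (b : RootedMap p n) (T : E) : ℝ :=
  (∑ x : LabelledRootedMap p n with (Quotient.mk _ x : RootedMap p n) = b,
      φ.val x.map (fun _ => T)) /
    (Finset.univ.filter
      (fun x : LabelledRootedMap p n => (Quotient.mk _ x : RootedMap p n) = b)).card

/-- The `n`-th moment `m_n(T) = ∑_{b ∈ 𝓑ₙ} b(T)`, with `m_0(T) = 1`. -/
noncomputable def moment (φ : TensorDistribution p E) (n : ℕ) (T : E) : ℝ :=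
  if n = 0 then 1 else ∑ b : RootedMap p n, φ.rootedVal b T

end TensorDistribution

section RealTensors

variable {p : ℕ} {V W : Type}

theorem TraceMap.numComponents_relabel (b : TraceMap p V) (e : V ≃ W) :
    (b.relabel e).numComponents = b.numComponents := by
  refine (Nat.card_congr (SimpleGraph.Iso.connectedComponentEquiv (⟨e, ?_⟩ :
    b.graph ≃g (b.relabel e).graph))).symm
  intro v w
  have key : ∀ v w : V, (∃ i j, (b.relabel e).α (e v, i) = (e w, j)) ↔
      ∃ i j, b.α (v, i) = (w, j) := by
    intro v w
    refine exists₂_congr fun i j => ?_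
    simp [TraceMap.relabel, Equiv.permCongr_apply, Prod.ext_iff]
  simp only [TraceMap.graph, SimpleGraph.fromRel_adj, key, ne_eq, e.injective.eq_iff]

theorem TraceMap.graph_disjUnion (b : TraceMap p V) (c : TraceMap p W) :
    (b.disjUnion c).graph = b.graph ⊕g c.graph := by
  ext x y
  rcases x with v | w <;> rcases y with v' | w' <;>
  simp [TraceMap.graph, TraceMap.disjUnion, Equiv.permCongr_apply, Prod.ext_iff,
    SimpleGraph.fromRel_adj]

theorem TraceMap.numComponents_disjUnion [Finite V] [Finite W]
    (b : TraceMap p V) (c : TraceMap p W) :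
    (b.disjUnion c).numComponents = b.numComponents + c.numComponents := by
  unfold TraceMap.numComponents
  rw [TraceMap.graph_disjUnion, ← Nat.card_sum]
  symm
  refine Nat.card_congr (Equiv.ofBijective (Sum.elim
    (SimpleGraph.ConnectedComponent.map SimpleGraph.Embedding.sumInl.toHom)
    (SimpleGraph.ConnectedComponent.map SimpleGraph.Embedding.sumInr.toHom)) ⟨?_, ?_⟩)
  · have adjL : ∀ {x y : V ⊕ W}, (b.graph ⊕g c.graph).Walk x y → ∀ v w, x = Sum.inl v →
        y = Sum.inl w → b.graph.Reachable v w := by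
      intro x y q
      induction q with
      | nil => rintro v w h₁ h₂; cases h₁.symm.trans h₂; rfl
      | @cons x y z h q ih =>
        rintro v w rfl rfl
        rcases y with y | y
        · exact (SimpleGraph.Adj.reachable (by simpa using h)).trans (ih y w rfl rfl)
        · simp at h
    have adjR : ∀ {x y : V ⊕ W}, (b.graph ⊕g c.graph).Walk x y → ∀ v w, x = Sum.inr v →
        y = Sum.inr w → c.graph.Reachable v w := by
      intro x y q
      induction q with
      | nil => rintro v w h₁ h₂; cases h₁.symm.trans h₂; rfl
      | @cons x y z h q ih =>
        rintro v w rfl rfl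
        rcases y with y | y
        · simp at h
        · exact (SimpleGraph.Adj.reachable (by simpa using h)).trans (ih y w rfl rfl)
    rintro (x | x) (y | y) <;> induction x using SimpleGraph.ConnectedComponent.ind <;>
      induction y using SimpleGraph.ConnectedComponent.ind <;> intro h <;>
      simp only [Sum.elim_inl, Sum.elim_inr, SimpleGraph.ConnectedComponent.map_mk,
        SimpleGraph.ConnectedComponent.eq] at h
    · obtain ⟨q⟩ := h
      exact congrArg Sum.inl (SimpleGraph.ConnectedComponent.eq.2 (adjL q _ _ rfl rfl))
    · exact absurd h (SimpleGraph.not_reachable_sum_inl_inr _ _)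
    · exact absurd h.symm (SimpleGraph.not_reachable_sum_inl_inr _ _)
    · obtain ⟨q⟩ := h
      exact congrArg Sum.inr (SimpleGraph.ConnectedComponent.eq.2 (adjR q _ _ rfl rfl))
  · intro x
    induction x using SimpleGraph.ConnectedComponent.ind with
    | _ v =>
    rcases v with v | w
    · exact ⟨Sum.inl (b.graph.connectedComponentMk v), rfl⟩
    · exact ⟨Sum.inr (c.graph.connectedComponentMk w), rfl⟩

/-- Assignments of an index to every edge. -/
abbrev TraceMap.Index (b : TraceMap p V) (N : ℕ) : Type :=
  {i : V × Fin p → Fin N // ∀ h, i (b.α h) = i h}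

noncomputable instance [Finite V] (b : TraceMap p V) (N : ℕ) : Fintype (b.Index N) :=
  Fintype.ofFinite _

open Classical in
/-- The trace invariant `N ^ (-γ(b)) * ∑_i ∏_v (T_v)_{i_{∂v}}` of real tensors `T_v` of order `p`
whose legs have dimension `N`. -/
noncomputable def TraceMap.traceInvariant [Finite V] (b : TraceMap p V) (N : ℕ) :
    MultilinearMap ℝ (fun _ : V => (Fin p → Fin N) → ℝ) ℝ :=
  letI := Fintype.ofFinite V
  ((N : ℝ) ^ b.numComponents)⁻¹ • ∑ i : b.Index N,
    (MultilinearMap.mkPiAlgebra ℝ V ℝ).compLinearMap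
      (fun v => LinearMap.proj (fun j => i.1 (v, j)))

theorem TraceMap.traceInvariant_apply [Fintype V] (b : TraceMap p V) (N : ℕ)
    (T : V → (Fin p → Fin N) → ℝ) :
    b.traceInvariant N T = ((N : ℝ) ^ b.numComponents)⁻¹ *
      ∑ i : b.Index N, ∏ v, T v (fun j => i.1 (v, j)) := by
  simp only [TraceMap.traceInvariant, smul_apply, smul_eq_mul,
    sum_apply, MultilinearMap.compLinearMap_apply, MultilinearMap.mkPiAlgebra_apply,
    LinearMap.proj_apply]
  congr! 3
  ext
  simp

/-- An index for a disjoint union is a pair of indices. -/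
def TraceMap.indexDisjUnion (b : TraceMap p V) (c : TraceMap p W) (N : ℕ) :
    (b.disjUnion c).Index N ≃ b.Index N × c.Index N where
  toFun := fun i =>
    (⟨fun h => i.1 (Sum.inl h.1, h.2), fun h => by
        simpa [TraceMap.disjUnion, Equiv.permCongr_apply] using i.2 (Sum.inl h.1, h.2)⟩,
      ⟨fun h => i.1 (Sum.inr h.1, h.2), fun h => by
        simpa [TraceMap.disjUnion, Equiv.permCongr_apply] using i.2 (Sum.inr h.1, h.2)⟩)
  invFun := fun q =>
    ⟨fun h => Sum.elim (fun v => q.1.1 (v, h.2)) (fun w => q.2.1 (w, h.2)) h.1, by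
      rintro ⟨v | w, j⟩
      · simpa [TraceMap.disjUnion, Equiv.permCongr_apply] using q.1.2 (v, j)
      · simpa [TraceMap.disjUnion, Equiv.permCongr_apply] using q.2.2 (w, j)⟩
  left_inv := fun i => by
    refine Subtype.ext (funext ?_)
    rintro ⟨v | w, j⟩ <;> rfl
  right_inv := fun q => rfl

/-- The distribution of real tensors of order `p` whose legs have dimension `N`. -/
noncomputable def TensorDistribution.real (p N : ℕ) :
    TensorDistribution p ((Fin p → Fin N) → ℝ) where
  val b := b.traceInvariant N
  val_relabel {V W} _ _ b e T := by
    let := Fintype.ofFinite V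
    let := Fintype.ofFinite W
    rw [TraceMap.traceInvariant_apply, TraceMap.traceInvariant_apply,
      TraceMap.numComponents_relabel]
    congr 1
    refine Fintype.sum_equiv
      ((Equiv.arrowCongr (Equiv.prodCongr e.symm (Equiv.refl (Fin p)))
        (Equiv.refl (Fin N))).subtypeEquiv fun i => ?_) _ _ fun i => ?_
    · rw [(Equiv.prodCongr e (Equiv.refl (Fin p))).symm.forall_congr_left]
      simp [TraceMap.relabel, Equiv.permCongr_apply, Equiv.arrowCongr]
    · exact (Fintype.prod_equiv e _ _ fun v => rfl).symm
  val_disjUnion {V W} _ _ b c T := by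
    let := Fintype.ofFinite V
    let := Fintype.ofFinite W
    rw [TraceMap.traceInvariant_apply, TraceMap.traceInvariant_apply,
      TraceMap.traceInvariant_apply, TraceMap.numComponents_disjUnion, pow_add, mul_inv,
      mul_mul_mul_comm, Fintype.sum_mul_sum, ← Fintype.sum_prod_type']
    congr 1
    refine Fintype.sum_equiv
      (b.indexDisjUnion c N) _ _ fun i => ?_
    simp only [Fintype.prod_sum_type]
    rfl
  val_empty {V} _ _ b T := by
    let := Fintype.ofFinite V
    rw [TraceMap.traceInvariant_apply]
    have h0 : b.numComponents = 0 := by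
      have : IsEmpty b.graph.ConnectedComponent :=
        ⟨fun x => x.ind (fun v => isEmptyElim v)⟩
      exact Nat.card_of_isEmpty
    have : Unique (b.Index N) :=
      ⟨⟨⟨fun h => isEmptyElim h.1, fun h => isEmptyElim h.1⟩⟩,
        fun i => Subtype.ext (funext fun h => isEmptyElim h.1)⟩
    simp [h0]

end RealTensors

/-- The Fuss-Catalan number `F_p(k)`. -/
noncomputable def fussCatalan (p k : ℕ) : ℝ := ((p * k + 1).choose k : ℝ) / ((p * k + 1 : ℕ) : ℝ)

/-- `μ` is the high order semicircular law `μ_p`: the compactly supported probability measure on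
`ℝ` with moments `F_p(n / 2)` for even `n` and `0` for odd `n`. -/
structure IsHighOrderSemicircular (p : ℕ) (μ : Measure ℝ) : Prop where
  isProbabilityMeasure : IsProbabilityMeasure μ
  compact_support : ∃ R : ℝ, μ (Set.Icc (-R) R)ᶜ = 0
  integral_pow_even : ∀ k : ℕ, ∫ x, x ^ (2 * k) ∂μ = fussCatalan p k
  integral_pow_odd : ∀ k : ℕ, ∫ x, x ^ (2 * k + 1) ∂μ = 0

/-! Moments are expressed by free cumulants through a functional equation. Inserting the
moment-cumulant formula into the sum over connected maps on `n` labelled vertices gives the sum over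
all maps `c` of `κ_c` times the number of connected maps above `c`.

Since `p` is even no map has a bridge, so the order is generated by mergings: two edges in different
components are cut and reconnected crosswise. The key point is `join_le_of_le`: if `b ≤ c` and `c`
pairs `x` with another half-edge `z` than `b` does, then `z` lies in another component of `b`, and
joining `x` to `z` stays below `c`. Hence a connected map above `b` can be explored edge by edge,
each edge being kept or joined to one of the `p * s` half-edges of a component of size `s`. The
number of such maps depends only on the component sizes (`upCount_eq_mergeCount`).

Cumulants are multiplicative over disjoint unions (`cumulant_glue`). With `p = 2 * q` and `K_s` the
sum of the cumulants of the connected maps on `s` labelled vertices, this yields `∑ m_n z^n = M(z /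
p)`, where `M = 1 + ∑_s p * s * K_s / s! * z^s * M^(q * s)`; `cumulantPoly p q K a n` is `n!` times
the coefficient of `z^n` in `M^a`. The passage from labelled to rooted maps costs the constant
factor `n! * p^n`, because connected rooted maps have no automorphisms (`card_class`).

Free independence makes `K_s` additive, so `K_s(T^k) = k^(-s/2) * ∑ K_s(T_i)`. The assumptions give
`K_1 = 0` and `K_2 = p`, and a bound on the moments bounds every `K_s(T_i)` uniformly in `i`, so the
orders `s ≥ 3` vanish in the limit. What remains is `M = 1 + p^2 * z^2 * M^p`, the equation of the
Fuss-Catalan numbers up to scaling. These are the moments of a product of independent beta variables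
and a constant; a symmetrized square root of this product has law `μ_p`. -/

namespace TraceMap

/-! ### Connectivity, switches and the absence of bridges -/

variable {p : ℕ} {V W : Type}

/-- A set of vertices is closed if no edge leaves it. -/
def Closed (b : TraceMap p V) (S : Set V) : Prop := ∀ h, h.1 ∈ S → (b.α h).1 ∈ S

/-- Two vertices lie in the same connected component. -/
def Rel (b : TraceMap p V) (u v : V) : Prop := b.graph.Reachable u v

theorem Rel.refl (b : TraceMap p V) (u : V) : b.Rel u u := SimpleGraph.Reachable.refl u

theorem Rel.symm {b : TraceMap p V} {u v : V} (h : b.Rel u v) : b.Rel v u :=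
  SimpleGraph.Reachable.symm h

theorem Rel.trans {b : TraceMap p V} {u v w : V} (h : b.Rel u v) (h' : b.Rel v w) : b.Rel u w :=
  SimpleGraph.Reachable.trans h h'

theorem rel_α (b : TraceMap p V) (h : V × Fin p) : b.Rel h.1 (b.α h).1 := by
  by_cases hh : h.1 = (b.α h).1
  · rw [← hh]; exact Rel.refl _ _
  · refine SimpleGraph.Adj.reachable ?_
    rw [graph, SimpleGraph.fromRel_adj]
    exact ⟨hh, Or.inl ⟨h.2, (b.α h).2, rfl⟩⟩

theorem Closed.rel {b : TraceMap p V} {S : Set V} (hS : b.Closed S) {u v : V} (h : b.Rel u v)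
    (hu : u ∈ S) : v ∈ S := by
  obtain ⟨q⟩ := h
  induction q with
  | nil => exact hu
  | @cons x y z h q ih =>
    refine ih ?_
    rw [graph, SimpleGraph.fromRel_adj] at h
    rcases h.2 with ⟨i, j, hij⟩ | ⟨i, j, hij⟩
    · have := hS (x, i) hu
      rwa [hij] at this
    · have h2 : b.α (x, j) = (y, i) := by rw [← hij, b.invol]
      have := hS (x, j) hu
      rwa [h2] at this

theorem closed_setOf_rel (b : TraceMap p V) (u : V) : b.Closed {v | b.Rel u v} :=
  fun h hh => Rel.trans hh (b.rel_α h)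

/-- Closed sets replace paths from here on: the effect of a switch, a renaming or a union on closed
sets is immediate, and reachability is read off from them. -/
theorem rel_iff {b : TraceMap p V} {u v : V} :
    b.Rel u v ↔ ∀ S, b.Closed S → u ∈ S → v ∈ S :=
  ⟨fun h _ hS hu => hS.rel h hu, fun h => h _ (b.closed_setOf_rel u) (Rel.refl b u)⟩

theorem connected_iff_rel {b : TraceMap p V} :
    b.Connected ↔ (∀ u v, b.Rel u v) ∧ Nonempty V := by
  rw [Connected, SimpleGraph.connected_iff]; rfl

theorem connected_iff_closed {b : TraceMap p V} :
    b.Connected ↔ Nonempty V ∧ ∀ S, b.Closed S → S.Nonempty → S = Set.univ := by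
  rw [connected_iff_rel, and_comm]
  refine and_congr_right fun _ => ⟨fun h S hS ⟨u, hu⟩ => ?_, fun h u v => ?_⟩
  · exact Set.eq_univ_of_forall fun v => hS.rel (h u v) hu
  · have := h _ (b.closed_setOf_rel u) ⟨u, Rel.refl b u⟩
    have hv : v ∈ {v | b.Rel u v} := by rw [this]; trivial
    exact hv

theorem Closed.compl {b : TraceMap p V} {S : Set V} (hS : b.Closed S) : b.Closed Sᶜ := by
  intro h hh hc
  have := hS _ hc
  rw [b.invol] at this
  exact hh this

theorem Closed.mem_iff {b : TraceMap p V} {S : Set V} (hS : b.Closed S) (h : V × Fin p) :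
    (b.α h).1 ∈ S ↔ h.1 ∈ S := by
  refine ⟨fun hh => ?_, hS h⟩
  have := hS _ hh
  rwa [b.invol] at this

open Classical in
/-- Exchange the end points `x` and `y` of two edges. -/
noncomputable def exch (b : TraceMap p V) (x y : V × Fin p) : TraceMap p V where
  α := (Equiv.swap x y).permCongr b.α
  invol h := by simp [b.invol]
  no_fixed h := by
    intro hh
    rw [Equiv.permCongr_apply, ← Equiv.eq_symm_apply] at hh
    exact b.no_fixed _ hh

open Classical in
theorem exch_α (b : TraceMap p V) (x y h : V × Fin p) :
    (b.exch x y).α h = Equiv.swap x y (b.α (Equiv.swap x y h)) := by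
  simp [exch]

theorem exch_exch (b : TraceMap p V) (x y : V × Fin p) : (b.exch x y).exch x y = b := by
  classical
  ext1; ext1 h
  simp [exch_α]

theorem exch_comm (b : TraceMap p V) (x y : V × Fin p) : b.exch x y = b.exch y x := by
  classical
  ext1; ext1 h
  simp [exch_α, Equiv.swap_comm x y]

theorem Closed.exch {b : TraceMap p V} {S : Set V} (hS : b.Closed S) {x y : V × Fin p}
    (h : x.1 ∈ S ↔ y.1 ∈ S) : (b.exch x y).Closed S := by
  classical
  have key : ∀ k : V × Fin p, (Equiv.swap x y k).1 ∈ S ↔ k.1 ∈ S := by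
    intro k
    rw [Equiv.swap_apply_def]
    split_ifs with h1 h2
    · rw [h1, h]
    · rw [h2, h]
    · rfl
  intro k hk
  rw [exch_α, key, hS.mem_iff, key]
  exact hk

theorem even_card_of_involution {H : Type*} [DecidableEq H] (D : Finset H) (g : H → H)
    (h1 : ∀ h ∈ D, g h ∈ D) (h2 : ∀ h ∈ D, g (g h) = h) (h3 : ∀ h ∈ D, g h ≠ h) :
    Even D.card := by
  have := Finset.sum_involution (s := D) (f := fun _ => (1 : ZMod 2)) (fun h _ => g h)
    (fun _ _ => by decide) (fun h hh _ => h3 h hh) (fun h hh => h1 h hh) (fun h hh => h2 h hh)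
  rw [Finset.sum_const, nsmul_one] at this
  exact even_iff_two_dvd.2 ((ZMod.natCast_eq_zero_iff _ _).1 this)

/-- A map all of whose vertices have even degree has no bridges, so that exchanging end points of
edges in two different components merges these. -/
theorem mem_of_closed_exch [Finite V] (hp : Even p) {b : TraceMap p V} {S : Set V}
    {x y : V × Fin p} (hxy : ¬ b.Rel x.1 y.1) (hS : (b.exch x y).Closed S) (hx : x.1 ∈ S) :
    y.1 ∈ S := by
  classical
  have := Fintype.ofFinite V
  by_contra hy
  set c := b.exch x y with hc
  have hbyy := b.no_fixed y
  have hbxy : b.α x ≠ y := fun h => hxy (by rw [← h]; exact b.rel_α x)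
  have hbyx : b.α y ≠ x := fun h => hxy (by rw [← h]; exact (b.rel_α y).symm)
  have hcy : c.α y = b.α x := by
    rw [hc, exch_α, Equiv.swap_apply_right, Equiv.swap_apply_of_ne_of_ne (b.no_fixed x) hbxy]
  have hx' : (b.α x).1 ∉ S := by rw [← hcy, hS.mem_iff]; exact hy
  -- If `y` is outside `S`, the edge of `x` is the only edge of `b` that leaves the part of the
  -- component of `x` inside `S`. So `b.α` pairs off the half-edges of that part other than `x`,
  -- while their number plus one is a multiple of the even `p`.
  let D : Finset (V × Fin p) := Finset.univ.filter fun h => (h.1 ∈ S ∧ b.Rel x.1 h.1) ∧ h ≠ x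
  have hD : ∀ h ∈ D, b.α h ∈ D := by
    intro h hh
    simp only [D, Finset.mem_filter, Finset.mem_univ, true_and] at hh ⊢
    obtain ⟨⟨h1, h2⟩, h3⟩ := hh
    have h4 : b.α h ≠ x := by
      intro h4
      apply hx'
      rw [← h4, b.invol]
      exact h1
    have h5 : b.Rel x.1 (b.α h).1 := h2.trans (b.rel_α h)
    have h6 : b.α h ≠ y := by
      rintro h6
      rw [h6] at h5
      exact hxy h5
    have h7 : h ≠ y := by
      rintro rfl
      exact hxy h2
    refine ⟨⟨?_, h5⟩, h4⟩
    have := hS h h1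
    rwa [hc, exch_α, Equiv.swap_apply_of_ne_of_ne h3 h7, Equiv.swap_apply_of_ne_of_ne h4 h6] at this
  have h1 := even_card_of_involution D b.α hD (fun h _ => b.invol h) (fun h _ => b.no_fixed h)
  let A : Finset V := Finset.univ.filter fun v => v ∈ S ∧ b.Rel x.1 v
  have h2 : insert x D = A ×ˢ (Finset.univ : Finset (Fin p)) := by
    ext h
    simp only [D, A, Finset.mem_insert, Finset.mem_filter, Finset.mem_univ, true_and,
      Finset.mem_product, and_true]
    constructor
    · rintro (rfl | h)
      · exact ⟨hx, Rel.refl _ _⟩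
      · exact h.1
    · intro h'
      by_cases hhx : h = x
      · exact Or.inl hhx
      · exact Or.inr ⟨h', hhx⟩
  have h3 := congrArg Finset.card h2
  rw [Finset.card_insert_of_notMem (by simp [D]), Finset.card_product, Finset.card_univ,
    Fintype.card_fin] at h3
  have h4 : Even (D.card + 1) := by rw [h3]; exact hp.mul_left _
  rw [Nat.even_add_one] at h4
  exact h4 h1

/-- By the absence of bridges a closed set of the new map cannot separate `x` from `y`; exchanging
once more then carries it back to `b`. -/
theorem closed_exch_iff [Finite V] (hp : Even p) {b : TraceMap p V} {S : Set V} {x y : V × Fin p}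
    (hxy : ¬ b.Rel x.1 y.1) :
    (b.exch x y).Closed S ↔ b.Closed S ∧ (x.1 ∈ S ↔ y.1 ∈ S) := by
  refine ⟨fun h => ?_, fun h => h.1.exch h.2⟩
  have h1 : x.1 ∈ S ↔ y.1 ∈ S := ⟨mem_of_closed_exch hp hxy h, mem_of_closed_exch (x := y) (y := x)
    hp (fun h' => hxy h'.symm) (by rwa [exch_comm])⟩
  refine ⟨?_, h1⟩
  have := h.exch h1
  rwa [exch_exch] at this

theorem rel_exch_iff [Finite V] (hp : Even p) {b : TraceMap p V} {x y : V × Fin p}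
    (hxy : ¬ b.Rel x.1 y.1) {u v : V} :
    (b.exch x y).Rel u v ↔
      b.Rel u v ∨ ((b.Rel x.1 u ∨ b.Rel y.1 u) ∧ (b.Rel x.1 v ∨ b.Rel y.1 v)) := by
  constructor
  · intro h
    by_cases hu : b.Rel x.1 u ∨ b.Rel y.1 u
    · refine Or.inr ⟨hu, ?_⟩
      have hS : (b.exch x y).Closed {w | b.Rel x.1 w ∨ b.Rel y.1 w} := by
        rw [closed_exch_iff hp hxy]
        refine ⟨?_, by simp [Rel.refl]⟩
        rintro k (hk | hk)
        · exact Or.inl (hk.trans (b.rel_α k))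
        · exact Or.inr (hk.trans (b.rel_α k))
      exact hS.rel h hu
    · refine Or.inl ?_
      push Not at hu
      have hS : (b.exch x y).Closed {w | b.Rel u w} := by
        rw [closed_exch_iff hp hxy]
        refine ⟨b.closed_setOf_rel u, ?_⟩
        exact iff_of_false (fun h => hu.1 h.symm) (fun h => hu.2 h.symm)
      exact hS.rel h (Rel.refl _ _)
  · have mono : ∀ {u v}, b.Rel u v → (b.exch x y).Rel u v := by
      intro u v h
      rw [rel_iff]
      intro S hS hu
      exact ((closed_exch_iff hp hxy).1 hS).1.rel h hu
    have hj : (b.exch x y).Rel x.1 y.1 := by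
      rw [rel_iff]
      intro S hS hu
      exact ((closed_exch_iff hp hxy).1 hS).2.1 hu
    have h2 : ∀ {w}, (b.Rel x.1 w ∨ b.Rel y.1 w) → (b.exch x y).Rel x.1 w := by
      rintro w (h | h)
      · exact mono h
      · exact hj.trans (mono h)
    rintro (h | ⟨h, h'⟩)
    · exact mono h
    · exact (h2 h).symm.trans (h2 h')

theorem numComponents_exch [Finite V] (hp : Even p) {b : TraceMap p V} {x y : V × Fin p}
    (hxy : ¬ b.Rel x.1 y.1) : (b.exch x y).numComponents + 1 = b.numComponents := by
  classical
  have := Fintype.ofFinite V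
  have : Fintype b.graph.ConnectedComponent := Fintype.ofFinite _
  -- The components of `x` and `y` fuse and the others are untouched, so dropping the component of
  -- `y` leaves one representative for each new component.
  let f : {c : b.graph.ConnectedComponent // c ≠ b.graph.connectedComponentMk y.1} →
      (b.exch x y).graph.ConnectedComponent := fun c =>
    SimpleGraph.ConnectedComponent.lift (fun v => (b.exch x y).graph.connectedComponentMk v)
      (fun u v q _ => SimpleGraph.ConnectedComponent.eq.2
        ((rel_exch_iff hp hxy).2 (Or.inl ⟨q⟩))) c.1
  have hf : Function.Bijective f := by
    constructor
    · rintro ⟨c, hc⟩ ⟨d, hd⟩ h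
      induction c using SimpleGraph.ConnectedComponent.ind with
      | _ u =>
      induction d using SimpleGraph.ConnectedComponent.ind with
      | _ v =>
      simp only [f, SimpleGraph.ConnectedComponent.lift_mk, SimpleGraph.ConnectedComponent.eq] at h
      have hu : ¬ b.Rel y.1 u := fun h => hc (SimpleGraph.ConnectedComponent.eq.2 h.symm)
      have hv : ¬ b.Rel y.1 v := fun h => hd (SimpleGraph.ConnectedComponent.eq.2 h.symm)
      refine Subtype.ext (SimpleGraph.ConnectedComponent.eq.2 ?_)
      rcases (rel_exch_iff hp hxy).1 h with h | ⟨h | h, h' | h'⟩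
      · exact h
      · exact h.symm.trans h'
      · exact absurd h' hv
      · exact absurd h hu
      · exact absurd h hu
    · intro d
      induction d using SimpleGraph.ConnectedComponent.ind with
      | _ v =>
      by_cases hv : b.Rel y.1 v
      · refine ⟨⟨b.graph.connectedComponentMk x.1, fun h =>
          hxy (SimpleGraph.ConnectedComponent.eq.1 h)⟩, SimpleGraph.ConnectedComponent.eq.2 ?_⟩
        exact (rel_exch_iff hp hxy).2 (Or.inr ⟨Or.inl (Rel.refl _ _), Or.inr hv⟩)
      · exact ⟨⟨b.graph.connectedComponentMk v, fun h =>
          hv (SimpleGraph.ConnectedComponent.eq.1 h).symm⟩, rfl⟩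
  rw [numComponents, ← Nat.card_congr (Equiv.ofBijective f hf), numComponents,
    Nat.card_eq_fintype_card, Nat.card_eq_fintype_card, Fintype.card_subtype_compl,
    Fintype.card_subtype_eq]
  have : 0 < Fintype.card b.graph.ConnectedComponent :=
    Fintype.card_pos_iff.2 ⟨b.graph.connectedComponentMk y.1⟩
  omega

theorem numComponents_exch_le [Finite V] {b : TraceMap p V} {x y : V × Fin p}
    (hxy : b.Rel x.1 y.1) : b.numComponents ≤ (b.exch x y).numComponents := by
  have mono : ∀ {u v}, (b.exch x y).Rel u v → b.Rel u v := by
    intro u v h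
    rw [rel_iff] at h ⊢
    exact fun S hS => h S (hS.exch ⟨hS.rel hxy, hS.rel hxy.symm⟩)
  let f : (b.exch x y).graph.ConnectedComponent → b.graph.ConnectedComponent :=
    SimpleGraph.ConnectedComponent.lift (fun v => b.graph.connectedComponentMk v)
      (fun u v q _ => SimpleGraph.ConnectedComponent.eq.2 (mono ⟨q⟩))
  refine Nat.card_le_card_of_surjective f fun d => ?_
  induction d using SimpleGraph.ConnectedComponent.ind with
  | _ v => exact ⟨(b.exch x y).graph.connectedComponentMk v, rfl⟩

/-- `c` arises from `b` by a switch that merges two components. -/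
def Merge (b c : TraceMap p V) : Prop := ∃ x y, ¬ b.Rel x.1 y.1 ∧ c = b.exch x y

/-- An exchange inside one component never lowers `γ`, and an exchange across two components lowers
it by exactly one, so the condition on `γ` only says that the ends lie in different components. -/
theorem switchBelow_iff [Finite V] (hp : Even p) {b c : TraceMap p V} :
    SwitchBelow c b ↔ Merge b c := by
  classical
  constructor
  · rintro ⟨⟨x, y, h⟩, hn⟩
    have hc : c = b.exch x y := by
      ext1; ext1 k
      rw [exch_α]
      rw [show b.α (Equiv.swap x y k) = Equiv.swap x y (c.α k) by convert h k]
      simp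
    refine ⟨x, y, fun hxy => ?_, hc⟩
    have := numComponents_exch_le hxy
    rw [← hc] at this
    omega
  · rintro ⟨x, y, hxy, rfl⟩
    refine ⟨⟨x, y, fun k => ?_⟩, (numComponents_exch hp hxy).symm⟩
    rw [exch_α, Equiv.swap_apply_self]

theorem le_iff_merge [Finite V] (hp : Even p) {b c : TraceMap p V} :
    b ≤ c ↔ Relation.ReflTransGen Merge b c := by
  rw [← Relation.reflTransGen_swap]
  change Relation.ReflTransGen SwitchBelow c b ↔ _
  have : (SwitchBelow : TraceMap p V → TraceMap p V → Prop) = Function.swap Merge := by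
    ext c b
    exact switchBelow_iff hp
  rw [this]

theorem Merge.le [Finite V] (hp : Even p) {b c : TraceMap p V} (h : Merge b c) : b ≤ c :=
  (le_iff_merge hp).2 (Relation.ReflTransGen.single h)

theorem rel_of_le [Finite V] (hp : Even p) {b c : TraceMap p V} (h : b ≤ c) {u v : V}
    (huv : b.Rel u v) : c.Rel u v := by
  rw [le_iff_merge hp] at h
  induction h with
  | refl => exact huv
  | tail _ h ih =>
    obtain ⟨x, y, hxy, rfl⟩ := h
    exact (rel_exch_iff hp hxy).2 (Or.inl ih)


/-! ### Joining edges and the order -/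

/-- Replace the edges of `x` and `z` by an edge from `x` to `z` and one between their partners. -/
noncomputable def join (b : TraceMap p V) (x z : V × Fin p) : TraceMap p V := b.exch (b.α x) z

open Classical in
theorem join_α (b : TraceMap p V) {x z : V × Fin p} (h1 : z ≠ x) (h2 : z ≠ b.α x)
    (h : V × Fin p) : (b.join x z).α h = if h = x then z else if h = z then x else
      if h = b.α x then b.α z else if h = b.α z then b.α x else b.α h := by
  have e1 := b.invol x
  have e2 := b.invol z
  have e3 := b.invol h
  have n1 := b.no_fixed x
  have n2 := b.no_fixed z
  have n3 := b.no_fixed h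
  rw [join, exch_α]
  simp only [Equiv.swap_apply_def]
  grind

theorem join_apply_left {b : TraceMap p V} {x z : V × Fin p} (h1 : z ≠ x) (h2 : z ≠ b.α x) :
    (b.join x z).α x = z := by
  simp [join_α b h1 h2]

theorem join_apply_of_ne {b : TraceMap p V} {x z h : V × Fin p} (h1 : z ≠ x) (h2 : z ≠ b.α x)
    (hx : h ≠ x) (hz : h ≠ z) (hbx : h ≠ b.α x) (hbz : h ≠ b.α z) :
    (b.join x z).α h = b.α h := by
  simp [join_α b h1 h2, *]

theorem ne_of_not_rel {b : TraceMap p V} {x z : V × Fin p} (h : ¬ b.Rel x.1 z.1) :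
    z ≠ x ∧ z ≠ b.α x := by
  refine ⟨?_, ?_⟩
  · rintro rfl
    exact h (Rel.refl _ _)
  · rintro rfl
    exact h (b.rel_α x)

/-- Two new edges and agreement elsewhere determine the involution; identities between iterated
joins are proved through this criterion. -/
theorem eq_join_iff {b c : TraceMap p V} {x z : V × Fin p} (h1 : z ≠ x) (h2 : z ≠ b.α x) :
    c = b.join x z ↔ c.α x = z ∧ c.α (b.α x) = b.α z ∧
      ∀ h, h ≠ x → h ≠ z → h ≠ b.α x → h ≠ b.α z → c.α h = b.α h := by
  constructor
  · rintro rfl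
    refine ⟨join_apply_left h1 h2, ?_, fun h => join_apply_of_ne h1 h2⟩
    have := b.no_fixed x
    rw [join_α b h1 h2, if_neg this, if_neg h2.symm, if_pos rfl]
  · rintro ⟨e1, e2, e3⟩
    ext1; ext1 h
    rw [join_α b h1 h2]
    have e4 := c.invol x
    have e5 := c.invol (b.α x)
    grind

theorem join_comm {b : TraceMap p V} {x z : V × Fin p} (h1 : z ≠ x) (h2 : z ≠ b.α x) :
    b.join x z = b.join z x := by
  have h3 : x ≠ b.α z := fun h => h2 (by rw [h, b.invol])
  rw [eq_join_iff h1.symm h3, join_α b h1 h2, join_α b h1 h2]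
  have e1 := b.invol x
  have e2 := b.invol z
  have n1 := b.no_fixed x
  have n2 := b.no_fixed z
  refine ⟨by grind, by grind, fun h g1 g2 g3 g4 => join_apply_of_ne h1 h2 g2 g1 g4 g3⟩

/-- Together with `join_comm` this lets any of the four half-edges involved play the role of the
first argument. -/
theorem join_α_α {b : TraceMap p V} {x z : V × Fin p} (h1 : z ≠ x) (h2 : z ≠ b.α x) :
    b.join x z = b.join (b.α x) (b.α z) := by
  have h3 : b.α z ≠ b.α x := fun h => h1 (b.α.injective h)
  have h4 : b.α z ≠ b.α (b.α x) := fun h => h2 (b.α.injective h)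
  rw [eq_join_iff h3 h4]
  simp only [b.invol]
  obtain ⟨e1, e2, e3⟩ := (eq_join_iff (c := b.join x z) h1 h2).1 rfl
  exact ⟨e2, e1, fun h g1 g2 g3 g4 => e3 h g3 g4 g1 g2⟩

theorem rel_join_iff [Finite V] (hp : Even p) {b : TraceMap p V} {x z : V × Fin p}
    (hxz : ¬ b.Rel x.1 z.1) {u v : V} :
    (b.join x z).Rel u v ↔
      b.Rel u v ∨ ((b.Rel x.1 u ∨ b.Rel z.1 u) ∧ (b.Rel x.1 v ∨ b.Rel z.1 v)) := by
  have h : ∀ w, b.Rel (b.α x).1 w ↔ b.Rel x.1 w := fun w =>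
    ⟨fun h => (b.rel_α x).trans h, fun h => (b.rel_α x).symm.trans h⟩
  rw [join, rel_exch_iff hp (fun h' => hxz ((h _).1 h')), h, h]

theorem merge_join {b : TraceMap p V} {x z : V × Fin p} (hxz : ¬ b.Rel x.1 z.1) :
    Merge b (b.join x z) :=
  ⟨b.α x, z, fun h => hxz ((b.rel_α x).trans h), rfl⟩

theorem Merge.exists_join {b c : TraceMap p V} (h : Merge b c) :
    ∃ x z, ¬ b.Rel x.1 z.1 ∧ c = b.join x z := by
  obtain ⟨x, y, hxy, rfl⟩ := h
  refine ⟨b.α x, y, fun h => hxy ((b.rel_α x).trans h), ?_⟩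
  rw [join, b.invol]

/-- Here `c`, `d`, `e` stand for `b.join u w`, `b.join u z` and `c.join u z`. Both orders of joining
end with the edges `u z`, `w (b z)` and `(b u) (b w)`, so `e` is `d` with `w` joined to `b z`. -/
theorem join_aux_left {H : Type*} {u w z : H} {b c d e : H → H} (n1 : w ≠ u) (n2 : w ≠ b u)
    (n3 : z ≠ u) (n4 : z ≠ b u) (n5 : z ≠ w) (n6 : z ≠ b w) (hb : ∀ h, b (b h) = h)
    (hb' : ∀ h, b h ≠ h) (hc : ∀ h, c (c h) = h) (hd : ∀ h, d (d h) = h) (he : ∀ h, e (e h) = h)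
    (c1 : c u = w) (c2 : c (b u) = b w)
    (c3 : ∀ h, h ≠ u → h ≠ w → h ≠ b u → h ≠ b w → c h = b h)
    (d1 : d u = z) (d2 : d (b u) = b z)
    (d3 : ∀ h, h ≠ u → h ≠ z → h ≠ b u → h ≠ b z → d h = b h)
    (f1 : e u = z) (f2 : e (c u) = c z)
    (f3 : ∀ h, h ≠ u → h ≠ z → h ≠ c u → h ≠ c z → e h = c h) :
    e w = b z ∧ e (d w) = d (b z) ∧
      ∀ h, h ≠ w → h ≠ b z → h ≠ d w → h ≠ d (b z) → e h = d h := by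
  have k1 := hb u
  have k2 := hb w
  have k3 := hb z
  have k4 := hb' u
  have k5 := hb' w
  have k6 := hb' z
  have cz : c z = b z := c3 z n3 n5 n4 n6
  have dw : d w = b w := d3 w n1 n5.symm n2 (by grind)
  have dbz : d (b z) = b u := by rw [← d2, hd]
  have cbw : c (b w) = b u := by rw [← c2, hc]
  refine ⟨by rw [← c1, f2, cz], ?_, fun h h1 h2 h3 h4 => ?_⟩
  · rw [dw, dbz, f3 (b w) (by grind) (by grind) (by grind) (by grind), cbw]
  · rw [dw] at h3
    rw [dbz] at h4
    by_cases hu : h = u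
    · rw [hu, f1, d1]
    by_cases hz : h = z
    · rw [hz, ← f1, he, f1, ← d1, hd]
    rw [f3 h hu hz (by rwa [c1]) (by rwa [cz]), c3 h hu h1 h4 h3, d3 h hu hz h4 h2]

/-- Here `c`, `d`, `e` stand for `b.join u w`, `b.join x z` and `c.join x z`. The two joins touch
disjoint sets of edges and therefore commute. -/
theorem join_aux_of_ne {H : Type*} {u w x z : H} {b c d e : H → H} (hx1 : x ≠ u) (hx2 : x ≠ b u)
    (hx3 : x ≠ w) (hx4 : x ≠ b w) (hz1 : z ≠ u) (hz2 : z ≠ b u) (hz3 : z ≠ w)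
    (hz4 : z ≠ b w) (hb : ∀ h, b (b h) = h)
    (hd : ∀ h, d (d h) = h) (he : ∀ h, e (e h) = h)
    (c1 : c u = w) (c2 : c (b u) = b w)
    (c3 : ∀ h, h ≠ u → h ≠ w → h ≠ b u → h ≠ b w → c h = b h)
    (d1 : d x = z) (d2 : d (b x) = b z)
    (d3 : ∀ h, h ≠ x → h ≠ z → h ≠ b x → h ≠ b z → d h = b h)
    (f1 : e x = z) (f2 : e (c x) = c z)
    (f3 : ∀ h, h ≠ x → h ≠ z → h ≠ c x → h ≠ c z → e h = c h) :
    e u = w ∧ e (d u) = d w ∧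
      ∀ h, h ≠ u → h ≠ w → h ≠ d u → h ≠ d w → e h = d h := by
  have k1 := hb u
  have k2 := hb w
  have k3 := hb z
  have k7 := hb x
  have cx : c x = b x := c3 x hx1 hx3 hx2 hx4
  have cz : c z = b z := c3 z hz1 hz3 hz2 hz4
  have du : d u = b u := d3 u hx1.symm hz1.symm (by grind) (by grind)
  have dw : d w = b w := d3 w hx3.symm hz3.symm (by grind) (by grind)
  rw [cx, cz] at f2
  rw [cx, cz] at f3
  rw [du, dw]
  refine ⟨?_, ?_, fun h h1 h2 h3 h4 => ?_⟩
  · rw [f3 u hx1.symm hz1.symm (by grind) (by grind), c1]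
  · rw [f3 (b u) hx2.symm hz2.symm (by grind) (by grind), c2]
  · by_cases g1 : h = x
    · rw [g1, f1, d1]
    by_cases g2 : h = z
    · rw [g2, ← f1, he, f1, ← d1, hd]
    by_cases g3 : h = b x
    · rw [g3, f2, d2]
    by_cases g4 : h = b z
    · rw [g4, ← f2, he, f2, ← d2, hd]
    rw [f3 h g1 g2 g3 g4, c3 h h1 h2 h3 h4, d3 h g1 g2 g3 g4]

/-- Joining `u` to `w` and then `u` to a third component amounts to joining `u` to that component
first. -/
theorem join_join_left [Finite V] (hp : Even p) {b : TraceMap p V} {u w z : V × Fin p}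
    (huw : ¬ b.Rel u.1 w.1) (hz : ¬ (b.join u w).Rel u.1 z.1) :
    Merge (b.join u z) ((b.join u w).join u z) := by
  rw [rel_join_iff hp huw] at hz
  push Not at hz
  obtain ⟨hz1, hz2⟩ := hz
  obtain ⟨-, hz2⟩ := hz2 (Or.inl (Rel.refl _ _))
  obtain ⟨n1, n2⟩ := ne_of_not_rel huw
  obtain ⟨n3, n4⟩ := ne_of_not_rel hz1
  obtain ⟨n5, n6⟩ := ne_of_not_rel hz2
  have hr : ¬ (b.join u z).Rel w.1 (b.α z).1 := by
    rw [rel_join_iff hp hz1]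
    rintro (h | ⟨h | h, -⟩)
    · exact hz2 (h.trans (b.rel_α z).symm)
    · exact huw h
    · exact hz2 h.symm
  have key : (b.join u w).join u z = (b.join u z).join w (b.α z) := by
    obtain ⟨m1, m2⟩ := ne_of_not_rel hr
    rw [eq_join_iff m1 m2]
    have q1 : (b.join u w).α u = w := join_apply_left n1 n2
    have q2 : z ≠ (b.join u w).α u := by rw [q1]; exact n5
    obtain ⟨c1, c2, c3⟩ := (eq_join_iff (c := b.join u w) n1 n2).1 rfl
    obtain ⟨d1, d2, d3⟩ := (eq_join_iff (c := b.join u z) n3 n4).1 rfl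
    obtain ⟨f1, f2, f3⟩ := (eq_join_iff (c := (b.join u w).join u z) n3 q2).1 rfl
    exact join_aux_left n1 n2 n3 n4 n5 n6 b.invol b.no_fixed (b.join u w).invol (b.join u z).invol
      ((b.join u w).join u z).invol c1 c2 c3 d1 d2 d3 f1 f2 f3
  rw [key]
  exact merge_join hr

theorem join_join_of_ne [Finite V] (hp : Even p) {b : TraceMap p V} {u w x z : V × Fin p}
    (huw : ¬ b.Rel u.1 w.1) (hz : ¬ (b.join u w).Rel x.1 z.1) (hx1 : x ≠ u) (hx2 : x ≠ b.α u)
    (hx3 : x ≠ w) (hx4 : x ≠ b.α w) (hz1 : z ≠ u) (hz2 : z ≠ b.α u) (hz3 : z ≠ w)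
    (hz4 : z ≠ b.α w) :
    Merge (b.join x z) ((b.join u w).join x z) := by
  rw [rel_join_iff hp huw] at hz
  push Not at hz
  obtain ⟨hxz, hz⟩ := hz
  obtain ⟨n1, n2⟩ := ne_of_not_rel huw
  obtain ⟨n3, n4⟩ := ne_of_not_rel hxz
  have hr : ¬ (b.join x z).Rel u.1 w.1 := by
    rw [rel_join_iff hp hxz]
    rintro (h | ⟨h | h, h' | h'⟩)
    · exact huw h
    · exact huw (h.symm.trans h')
    · exact (hz (Or.inl h.symm)).2 h'.symm
    · exact (hz (Or.inr h'.symm)).1 h.symm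
    · exact huw (h.symm.trans h')
  have key : (b.join u w).join x z = (b.join x z).join u w := by
    obtain ⟨m1, m2⟩ := ne_of_not_rel hr
    rw [eq_join_iff m1 m2]
    have q1 : (b.join u w).α x = b.α x := join_apply_of_ne n1 n2 hx1 hx3 hx2 hx4
    have q2 : z ≠ (b.join u w).α x := by rw [q1]; exact n4
    obtain ⟨c1, c2, c3⟩ := (eq_join_iff (c := b.join u w) n1 n2).1 rfl
    obtain ⟨d1, d2, d3⟩ := (eq_join_iff (c := b.join x z) n3 n4).1 rfl
    obtain ⟨f1, f2, f3⟩ := (eq_join_iff (c := (b.join u w).join x z) n3 q2).1 rfl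
    exact join_aux_of_ne hx1 hx2 hx3 hx4 hz1 hz2 hz3 hz4 b.invol (b.join x z).invol
      ((b.join u w).join x z).invol c1 c2 c3 d1 d2 d3 f1 f2 f3
  rw [key]
  exact merge_join hr

/-- Joining is monotone on single mergings. Either the two operations use disjoint edges and
commute, or they share an edge and the symmetries of `join` reduce to a common first half-edge. -/
theorem Merge.join [Finite V] (hp : Even p) {b c : TraceMap p V} (h : Merge b c)
    {x z : V × Fin p} (hxz : ¬ c.Rel x.1 z.1) : Merge (b.join x z) (c.join x z) := by
  -- the case in which `x` lies on an edge involved in the merging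
  have left : ∀ {x z : V × Fin p}, ¬ c.Rel x.1 z.1 → ∀ {u w : V × Fin p}, ¬ b.Rel u.1 w.1 →
      c = b.join u w → (x = u ∨ x = b.α u ∨ x = w ∨ x = b.α w) →
      Merge (b.join x z) (c.join x z) := by
    intro x z hxz u w huw hc hx
    obtain ⟨n1, n2⟩ := ne_of_not_rel huw
    have huw' : ¬ b.Rel (b.α u).1 (b.α w).1 := fun h =>
      huw ((b.rel_α u).trans (h.trans (b.rel_α w).symm))
    obtain ⟨n3, n4⟩ := ne_of_not_rel huw'
    rcases hx with rfl | rfl | rfl | rfl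
    · subst hc
      exact join_join_left hp huw hxz
    · rw [join_α_α n1 n2] at hc
      subst hc
      exact join_join_left hp huw' hxz
    · rw [join_comm n1 n2] at hc
      subst hc
      exact join_join_left hp (fun h => huw h.symm) hxz
    · rw [join_α_α n1 n2, join_comm n3 n4] at hc
      subst hc
      exact join_join_left hp (fun h => huw' h.symm) hxz
  have hxz' : ¬ b.Rel x.1 z.1 := fun h' => hxz (rel_of_le hp (h.le hp) h')
  obtain ⟨u, w, huw, hc⟩ := h.exists_join
  by_cases hx : x = u ∨ x = b.α u ∨ x = w ∨ x = b.α w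
  · exact left hxz huw hc hx
  by_cases hz : z = u ∨ z = b.α u ∨ z = w ∨ z = b.α w
  · obtain ⟨n1, n2⟩ := ne_of_not_rel hxz
    obtain ⟨n3, n4⟩ := ne_of_not_rel hxz'
    rw [join_comm n1 n2, join_comm n3 n4]
    exact left (fun h => hxz h.symm) huw hc hz
  · push Not at hx hz
    subst hc
    exact join_join_of_ne hp huw hxz hx.1 hx.2.1 hx.2.2.1 hx.2.2.2 hz.1 hz.2.1 hz.2.2.1 hz.2.2.2

theorem join_le_join [Finite V] (hp : Even p) {b c : TraceMap p V} (h : b ≤ c)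
    {x z : V × Fin p} (hxz : ¬ c.Rel x.1 z.1) : b.join x z ≤ c.join x z := by
  rw [le_iff_merge hp] at h
  induction h with
  | refl => exact le_refl _
  | @tail d e _ h ih =>
    exact (ih (fun h' => hxz (rel_of_le hp (h.le hp) h'))).trans ((h.join hp hxz).le hp)

/-- If `x` has different partners in `b ≤ c`, then `b` can be made to agree with `c` at `x` by a
merging below `c`. -/
theorem join_le_of_le [Finite V] (hp : Even p) {b c : TraceMap p V} (h : b ≤ c)
    {x : V × Fin p} (hx : c.α x ≠ b.α x) :
    ¬ b.Rel x.1 (c.α x).1 ∧ b.join x (c.α x) ≤ c := by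
  have h' := (le_iff_merge hp).1 h
  clear h
  induction h' with
  | refl => exact absurd rfl hx
  | @tail d e hd h ih =>
    by_cases hdx : e.α x = d.α x
    · rw [hdx] at hx ⊢
      exact ⟨(ih hx).1, (ih hx).2.trans (h.le hp)⟩
    · have hbd : b ≤ d := (le_iff_merge hp).2 hd
      -- The last merging changes the partner of `x`, so it is itself the join of `x` with its new
      -- partner. Monotonicity of this join carries `b ≤ d` to the required inequality.
      suffices hs : ¬ d.Rel x.1 (e.α x).1 ∧ e = d.join x (e.α x) by
        refine ⟨fun h' => hs.1 (rel_of_le hp hbd h'), ?_⟩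
        have := join_le_join hp hbd hs.1
        rwa [← hs.2] at this
      obtain ⟨u, w, huw, he⟩ := h.exists_join
      obtain ⟨n1, n2⟩ := ne_of_not_rel huw
      have huw' : ¬ d.Rel (d.α u).1 (d.α w).1 := fun h =>
        huw ((d.rel_α u).trans (h.trans (d.rel_α w).symm))
      obtain ⟨n3, n4⟩ := ne_of_not_rel huw'
      have gen : ∀ {u w}, ¬ d.Rel u.1 w.1 → e = d.join u w → x = u →
          ¬ d.Rel x.1 (e.α x).1 ∧ e = d.join x (e.α x) := by
        rintro u w huw rfl rfl
        obtain ⟨n1, n2⟩ := ne_of_not_rel huw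
        rw [join_apply_left n1 n2]
        exact ⟨huw, rfl⟩
      by_cases h1 : x = u
      · exact gen huw he h1
      by_cases h2 : x = d.α u
      · rw [join_α_α n1 n2] at he
        exact gen huw' he h2
      by_cases h3 : x = w
      · rw [join_comm n1 n2] at he
        exact gen (fun h => huw h.symm) he h3
      by_cases h4 : x = d.α w
      · rw [join_α_α n1 n2, join_comm n3 n4] at he
        exact gen (fun h => huw' h.symm) he h4
      · refine absurd ?_ hdx
        rw [he]
        exact join_apply_of_ne n1 n2 h1 h3 h2 h4

end TraceMap

/-! ### Counting the connected maps above a given map -/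

/-- The number of ways to merge a block with `a` free edges with blocks of `s` vertices, hence
`q * s` edges, for `s ∈ M`, where `m` is the number of elements of `M`. -/
def mergeCountAux (p q : ℕ) : ℕ → ℕ → Multiset ℕ → ℕ
  | 0, _, _ => 1
  | _ + 1, 0, _ => 0
  | m + 1, a + 1, M => mergeCountAux p q (m + 1) a M +
      (M.map fun s => p * s * mergeCountAux p q m (a + q * s) (M.erase s)).sum

/-- The number of ways to merge a block with `a` free edges with blocks of `s` vertices, hence
`q * s` edges, for `s ∈ M`. -/
def mergeCount (p q a : ℕ) (M : Multiset ℕ) : ℕ := mergeCountAux p q (Multiset.card M) a M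

theorem mergeCount_nil (p q a : ℕ) : mergeCount p q a 0 = 1 := by
  simp [mergeCount, mergeCountAux]

theorem mergeCount_zero {p q : ℕ} {M : Multiset ℕ} (h : M ≠ 0) : mergeCount p q 0 M = 0 := by
  obtain ⟨m, hm⟩ := Nat.exists_eq_succ_of_ne_zero (mt Multiset.card_eq_zero.1 h)
  simp [mergeCount, mergeCountAux, hm]

theorem mergeCount_succ (p q a : ℕ) (M : Multiset ℕ) :
    mergeCount p q (a + 1) M = mergeCount p q a M +
      (M.map fun s => p * s * mergeCount p q (a + q * s) (M.erase s)).sum := by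
  rcases h : Multiset.card M with _ | m
  · rw [Multiset.card_eq_zero] at h
    subst h
    simp [mergeCount_nil]
  · rw [mergeCount, mergeCount, h, mergeCountAux]
    congr 2
    refine Multiset.map_congr rfl fun s hs => ?_
    rw [mergeCount, Multiset.card_erase_of_mem hs, h]
    rfl

namespace TraceMap

variable {p : ℕ} {V W : Type}

section Components

variable [Fintype V]

open Classical in
/-- The component of a vertex. -/
noncomputable def comp (b : TraceMap p V) (u : V) : Finset V := Finset.univ.filter (b.Rel u)

@[simp]
theorem mem_comp {b : TraceMap p V} {u v : V} : v ∈ b.comp u ↔ b.Rel u v := by simp [comp]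

theorem comp_eq_comp_iff {b : TraceMap p V} {u v : V} : b.comp u = b.comp v ↔ b.Rel u v := by
  constructor
  · intro h
    rw [← mem_comp, h, mem_comp]
    exact Rel.refl _ _
  · intro h
    ext w
    rw [mem_comp, mem_comp]
    exact ⟨fun h' => h.symm.trans h', fun h' => h.trans h'⟩

open Classical in
/-- The set of components. -/
noncomputable def comps (b : TraceMap p V) : Finset (Finset V) := Finset.univ.image b.comp

theorem mem_comps {b : TraceMap p V} {C : Finset V} : C ∈ b.comps ↔ ∃ u, b.comp u = C := by
  simp [comps]

theorem comp_mem_comps (b : TraceMap p V) (u : V) : b.comp u ∈ b.comps := mem_comps.2 ⟨u, rfl⟩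

theorem eq_comp_of_mem {b : TraceMap p V} {C : Finset V} (hC : C ∈ b.comps) {u : V} (hu : u ∈ C) :
    C = b.comp u := by
  obtain ⟨v, rfl⟩ := mem_comps.1 hC
  exact comp_eq_comp_iff.2 (mem_comp.1 hu)

open Classical in
theorem comp_join (hp : Even p) {b : TraceMap p V} {x z : V × Fin p}
    (hxz : ¬ b.Rel x.1 z.1) (u : V) :
    (b.join x z).comp u = if b.Rel x.1 u ∨ b.Rel z.1 u then b.comp x.1 ∪ b.comp z.1
      else b.comp u := by
  ext v
  rw [mem_comp, rel_join_iff hp hxz]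
  split_ifs with h
  · simp only [h, true_and, Finset.mem_union, mem_comp, or_iff_right_iff_imp]
    intro h'
    exact h.imp (fun h => h.trans h') (fun h => h.trans h')
  · simp [h]

open Classical in
theorem comps_join_erase (hp : Even p) {b : TraceMap p V} {x z : V × Fin p}
    (hxz : ¬ b.Rel x.1 z.1) :
    (b.join x z).comps.erase ((b.join x z).comp x.1) =
      (b.comps.erase (b.comp x.1)).erase (b.comp z.1) := by
  have h0 : (b.join x z).comp x.1 = b.comp x.1 ∪ b.comp z.1 := by
    rw [comp_join hp hxz, if_pos (Or.inl (Rel.refl _ _))]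
  ext C
  simp only [Finset.mem_erase, mem_comps, ne_eq]
  constructor
  · rintro ⟨h1, u, rfl⟩
    have hu : ¬ (b.Rel x.1 u ∨ b.Rel z.1 u) := by
      intro hu
      apply h1
      rw [h0, comp_join hp hxz, if_pos hu]
    rw [comp_join hp hxz, if_neg hu, comp_eq_comp_iff, comp_eq_comp_iff]
    push Not at hu
    exact ⟨fun h => hu.2 h.symm, fun h => hu.1 h.symm, u, rfl⟩
  · rintro ⟨h1, h2, u, rfl⟩
    rw [comp_eq_comp_iff] at h1 h2
    have hu : ¬ (b.Rel x.1 u ∨ b.Rel z.1 u) := by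
      rintro (h | h)
      · exact h2 h.symm
      · exact h1 h.symm
    refine ⟨?_, u, by rw [comp_join hp hxz, if_neg hu]⟩
    rw [h0]
    intro h
    have : x.1 ∈ b.comp u := by rw [h]; simp [Rel.refl]
    exact h2 (mem_comp.1 this)

/-- The multiset of the sizes of the components. -/
noncomputable def sizes (b : TraceMap p V) : Multiset ℕ := b.comps.val.map Finset.card

open Classical in
theorem sizes_erase {b : TraceMap p V} {C : Finset V} (hC : C ∈ b.comps) :
    (b.comps.erase C).val.map Finset.card = b.sizes.erase C.card := by
  rw [sizes, Finset.erase_val, Multiset.map_erase_of_mem _ _ hC]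

open Classical in
/-- The number of the connected maps above `b` that agree with `b` off `S`. -/
noncomputable def upCount (b : TraceMap p V) (S : Finset (V × Fin p)) : ℕ :=
  (Finset.univ.filter fun c : TraceMap p V =>
    b ≤ c ∧ c.Connected ∧ ∀ h, h ∉ S → c.α h = b.α h).card

open Classical in
-- The set `S` holds the half-edges not yet decided. Either `c` keeps the edge of `x`, which is then
-- frozen, or `z = c.α x` is in another component by `join_le_of_le`; then the new edge `x z` is
-- frozen and the edge between the old partners stays free.
theorem upCount_eq (hp : Even p) (b : TraceMap p V) (S : Finset (V × Fin p))
    (hS : ∀ h ∈ S, b.α h ∈ S) (x : V × Fin p) (hx : x ∈ S)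
    (hSx : ∀ h : V × Fin p, ¬ b.Rel x.1 h.1 → h ∈ S) :
    b.upCount S = b.upCount ((S.erase x).erase (b.α x)) +
      ∑ z : V × Fin p with ¬ b.Rel x.1 z.1, (b.join x z).upCount ((S.erase x).erase z) := by
  have h0 : (Finset.univ.filter fun c : TraceMap p V =>
      b ≤ c ∧ c.Connected ∧ ∀ h, h ∉ S → c.α h = b.α h) =
      (Finset.univ.filter fun c : TraceMap p V => b ≤ c ∧ c.Connected ∧
        ∀ h, h ∉ (S.erase x).erase (b.α x) → c.α h = b.α h) ∪
      (Finset.univ.filter fun z : V × Fin p => ¬ b.Rel x.1 z.1).biUnion fun z =>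
        Finset.univ.filter fun c : TraceMap p V => b.join x z ≤ c ∧ c.Connected ∧
          ∀ h, h ∉ (S.erase x).erase z → c.α h = (b.join x z).α h := by
    ext c
    simp only [Finset.mem_filter, Finset.mem_univ, true_and, Finset.mem_union, Finset.mem_biUnion,
      Finset.mem_erase, not_and]
    constructor
    · rintro ⟨hbc, hc, hcS⟩
      by_cases hcx : c.α x = b.α x
      · refine Or.inl ⟨hbc, hc, fun h hh => ?_⟩
        by_cases h1 : h = b.α x
        · rw [h1, ← hcx, c.invol, hcx, b.invol]
        by_cases h2 : h = x
        · rw [h2, hcx]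
        exact hcS h (hh h1 h2)
      · obtain ⟨hr, hj⟩ := join_le_of_le hp hbc hcx
        obtain ⟨n1, n2⟩ := ne_of_not_rel hr
        refine Or.inr ⟨c.α x, hr, hj, hc, fun h hh => ?_⟩
        by_cases h1 : h = c.α x
        · rw [h1, c.invol, join_comm n1 n2, join_apply_left n1.symm]
          intro h
          exact n2 (by conv_rhs => rw [h, b.invol])
        by_cases h2 : h = x
        · rw [h2, join_apply_left n1 n2]
        have h3 := hh h1 h2
        rw [hcS h h3, join_apply_of_ne n1 n2 h2 h1]
        · rintro rfl
          exact h3 (hS _ hx)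
        · rintro rfl
          exact h3 (hS _ (hSx _ hr))
    · rintro (⟨hbc, hc, hcS⟩ | ⟨z, hz, hbc, hc, hcS⟩)
      · exact ⟨hbc, hc, fun h hh => hcS h (fun _ _ => hh)⟩
      · obtain ⟨n1, n2⟩ := ne_of_not_rel hz
        refine ⟨((merge_join hz).le hp).trans hbc, hc, fun h hh => ?_⟩
        rw [hcS h (fun _ _ => hh), join_apply_of_ne n1 n2]
        · rintro rfl
          exact hh hx
        · rintro rfl
          exact hh (hSx _ hz)
        · rintro rfl
          exact hh (hS _ hx)
        · rintro rfl
          exact hh (hS _ (hSx _ hz))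
  have hval : ∀ z, ¬ b.Rel x.1 z.1 → ∀ c : TraceMap p V,
      (∀ h, h ∉ (S.erase x).erase z → c.α h = (b.join x z).α h) → c.α x = z := by
    intro z hz c hc
    obtain ⟨n1, n2⟩ := ne_of_not_rel hz
    rw [hc x (by simp), join_apply_left n1 n2]
  rw [upCount, h0, Finset.card_union_of_disjoint, Finset.card_biUnion]
  · rfl
  · intro z hz z' hz' hne
    rw [Function.onFun, Finset.disjoint_left]
    intro c hc hc'
    simp only [Finset.mem_filter, Finset.mem_univ, true_and] at hc hc'
    exact hne ((hval z (by simpa using hz) c hc.2.2).symm.trans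
      (hval z' (by simpa using hz') c hc'.2.2))
  · rw [Finset.disjoint_left]
    intro c hc hc'
    simp only [Finset.mem_filter, Finset.mem_univ, true_and, Finset.mem_biUnion] at hc hc'
    obtain ⟨z, hz, hc'⟩ := hc'
    have h1 := hval z hz c hc'.2.2
    rw [hc.2.2 x (by simp)] at h1
    exact (ne_of_not_rel hz).2 h1.symm

open Classical in
-- Once the component of `v` is frozen it stays closed in every admissible map, so a connected one
-- exists only if this component is everything already.
theorem upCount_of_disjoint (b : TraceMap p V) (S : Finset (V × Fin p)) (v : V)
    (hS : ∀ h ∈ S, ¬ b.Rel v h.1) (hS' : ∀ h : V × Fin p, ¬ b.Rel v h.1 → h ∈ S) :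
    b.upCount S = if b.Connected then 1 else 0 := by
  have hclosed : ∀ c : TraceMap p V, (∀ h, h ∉ S → c.α h = b.α h) →
      c.Closed {w | b.Rel v w} := by
    intro c hc h hh
    rw [hc h (fun hhS => hS h hhS hh)]
    exact b.closed_setOf_rel v h hh
  split_ifs with hb
  · rw [upCount, Finset.card_eq_one]
    refine ⟨b, ?_⟩
    ext c
    simp only [Finset.mem_filter, Finset.mem_univ, true_and, Finset.mem_singleton]
    constructor
    · rintro ⟨-, -, h⟩
      ext1; ext1 k
      exact h k fun hk => hS k hk ((connected_iff_rel.1 hb).1 _ _)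
    · rintro rfl
      exact ⟨le_rfl, hb, fun _ _ => rfl⟩
  · rw [upCount, Finset.card_eq_zero, Finset.filter_eq_empty_iff]
    rintro c - ⟨hbc, hc, hcS⟩
    apply hb
    have h1 := (connected_iff_closed.1 hc).2 _ (hclosed c hcS) ⟨v, Rel.refl _ _⟩
    have h2 : ∀ w, b.Rel v w := fun w => by
      have : w ∈ {w | b.Rel v w} := by rw [h1]; trivial
      exact this
    exact connected_iff_rel.2 ⟨fun u w => (h2 u).symm.trans (h2 w), ⟨v⟩⟩

theorem connected_iff_comps {b : TraceMap p V} (v : V) [DecidableEq V] :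
    b.Connected ↔ b.comps.erase (b.comp v) = ∅ := by
  rw [connected_iff_rel, Finset.eq_empty_iff_forall_notMem]
  constructor
  · rintro ⟨h, -⟩ C hC
    rw [Finset.mem_erase, mem_comps] at hC
    obtain ⟨h1, u, rfl⟩ := hC
    exact h1 (comp_eq_comp_iff.2 (h _ _))
  · intro h
    have h2 : ∀ u, b.Rel v u := by
      intro u
      by_contra hu
      exact h (b.comp u) (Finset.mem_erase.2 ⟨fun h' => hu (comp_eq_comp_iff.1 h'.symm),
        comp_mem_comps b u⟩)
    exact ⟨fun u w => (h2 u).symm.trans (h2 w), ⟨v⟩⟩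

open Classical in
/-- The number of the connected maps above `b` depends only on the sizes of the components of `b`. -/
theorem upCount_eq_mergeCount {q : ℕ} (hpq : p = 2 * q) (m : ℕ) : ∀ (a : ℕ) (b : TraceMap p V)
    (S : Finset (V × Fin p)) (v : V), b.comps.card ≤ m → (∀ h ∈ S, b.α h ∈ S) →
    (∀ h : V × Fin p, ¬ b.Rel v h.1 → h ∈ S) →
    (S.filter fun h => b.Rel v h.1).card = 2 * a →
    b.upCount S = mergeCount p q a ((b.comps.erase (b.comp v)).val.map Finset.card) := by
  have hp : Even p := hpq ▸ even_two_mul q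
  -- Keeping an edge lowers the number `a` of free edges of the component of `v`; joining may raise
  -- `a` but lowers the number of components. Hence an outer induction on the latter and an inner
  -- one on `a`.
  induction m with
  | zero =>
    intro a b S v hm
    have := Finset.card_pos.2 ⟨_, comp_mem_comps b v⟩
    omega
  | succ m ihm =>
  intro a
  induction a with
  | zero =>
    intro b S v _ hS hSv hcard
    rw [mul_zero, Finset.card_eq_zero, Finset.filter_eq_empty_iff] at hcard
    rw [upCount_of_disjoint b S v hcard hSv]
    split_ifs with hb
    · rw [connected_iff_comps v] at hb
      rw [hb]
      simp [mergeCount_nil]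
    · rw [connected_iff_comps v] at hb
      rw [mergeCount_zero]
      rwa [Ne, Multiset.map_eq_zero, Finset.val_eq_zero]
  | succ a iha =>
    intro b S v hm hS hSv hcard
    obtain ⟨x, hx⟩ : (S.filter fun h => b.Rel v h.1).Nonempty := by
      rw [← Finset.card_pos]
      omega
    rw [Finset.mem_filter] at hx
    obtain ⟨hxS, hvx⟩ := hx
    have hcomp : b.comp v = b.comp x.1 := comp_eq_comp_iff.2 hvx
    have hR : ∀ w, b.Rel v w ↔ b.Rel x.1 w := fun w =>
      ⟨fun h => hvx.symm.trans h, fun h => hvx.trans h⟩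
    simp only [hR] at hSv hcard
    rw [hcomp, upCount_eq hp b S hS x hxS hSv, mergeCount_succ]
    have nbx := b.no_fixed x
    congr 1
    · rw [iha b ((S.erase x).erase (b.α x)) x.1 hm]
      · intro h hh
        simp only [Finset.mem_erase, ne_eq] at hh ⊢
        refine ⟨fun h' => hh.2.1 (b.α.injective h'), fun h' => hh.1 ?_, hS h hh.2.2⟩
        rw [← h', b.invol]
      · intro h hh
        simp only [Finset.mem_erase, ne_eq]
        refine ⟨?_, ?_, hSv h hh⟩
        · rintro rfl
          exact hh (b.rel_α x)
        · rintro rfl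
          exact hh (Rel.refl _ _)
      · rw [Finset.filter_erase, Finset.filter_erase, Finset.card_erase_of_mem,
          Finset.card_erase_of_mem, hcard]
        · omega
        · simp [hxS, Rel.refl]
        · simp [hS x hxS, b.rel_α x, nbx]
    · have h1 : ∀ z : V × Fin p, ¬ b.Rel x.1 z.1 →
          (b.join x z).upCount ((S.erase x).erase z) = mergeCount p q (a + q * (b.comp z.1).card)
            (((b.comps.erase (b.comp x.1)).erase (b.comp z.1)).val.map Finset.card) := by
        intro z hz
        obtain ⟨n1, n2⟩ := ne_of_not_rel hz
        have jx : (b.join x z).α x = z := join_apply_left n1 n2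
        have jz : (b.join x z).α z = x := by
          rw [join_comm n1 n2]
          exact join_apply_left n1.symm fun h => n2 (by rw [h, b.invol])
        have hbz : b.comp z.1 ∈ b.comps.erase (b.comp x.1) := by
          rw [Finset.mem_erase]
          exact ⟨fun h => hz (comp_eq_comp_iff.1 h.symm), comp_mem_comps _ _⟩
        have hjS : ∀ h ∈ S, (b.join x z).α h ∈ S := by
          intro h hh
          rw [join_α b n1 n2]
          split_ifs
          · exact hSv z hz
          · exact hxS
          · exact hS _ (hSv z hz)
          · exact hS _ hxS
          · exact hS h hh
        rw [← comps_join_erase hp hz]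
        apply ihm
        · have e1 : ((b.join x z).comps.erase ((b.join x z).comp x.1)).card + 1 =
              (b.join x z).comps.card := Finset.card_erase_add_one (comp_mem_comps _ _)
          have e2 := Finset.card_erase_add_one (comp_mem_comps b x.1)
          have e3 := Finset.card_erase_add_one hbz
          rw [comps_join_erase hp hz] at e1
          omega
        · intro h hh
          simp only [Finset.mem_erase, ne_eq] at hh ⊢
          refine ⟨?_, ?_, hjS h hh.2.2⟩
          · intro h'
            exact hh.2.1 ((b.join x z).α.injective (h'.trans jx.symm))
          · intro h'
            exact hh.1 ((b.join x z).α.injective (h'.trans jz.symm))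
        · intro h hh
          rw [rel_join_iff hp hz] at hh
          push Not at hh
          simp only [Finset.mem_erase, ne_eq]
          refine ⟨?_, ?_, hSv h hh.1⟩
          · rintro rfl
            exact (hh.2 (Or.inl (Rel.refl _ _))).2 (Rel.refl _ _)
          · rintro rfl
            exact hh.1 (Rel.refl _ _)
        · have e1 : (S.filter fun h => (b.join x z).Rel x.1 h.1) =
              (S.filter fun h => b.Rel x.1 h.1) ∪ (b.comp z.1 ×ˢ Finset.univ) := by
            ext h
            simp only [Finset.mem_filter, rel_join_iff hp hz, Finset.mem_union, Finset.mem_product,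
              mem_comp, Finset.mem_univ, and_true, Rel.refl, true_or, true_and]
            constructor
            · rintro ⟨g1, g2 | g2 | g2⟩
              · exact Or.inl ⟨g1, g2⟩
              · exact Or.inl ⟨g1, g2⟩
              · exact Or.inr g2
            · rintro (⟨g1, g2⟩ | g2)
              · exact ⟨g1, Or.inl g2⟩
              · exact ⟨hSv h fun h' => hz (h'.trans g2.symm), Or.inr (Or.inr g2)⟩
          rw [Finset.filter_erase, Finset.filter_erase, Finset.card_erase_of_mem,
            Finset.card_erase_of_mem, e1, Finset.card_union_of_disjoint, hcard,
            Finset.card_product, Finset.card_univ, Fintype.card_fin]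
          -- A component of size `s` brings in `p * s = 2 * (q * s)` half-edges, and `x` and `z` are
          -- used up: `2 * (a + 1) + 2 * q * s - 2 = 2 * (a + q * s)`.
          · have : (b.comp z.1).card * p = 2 * (q * (b.comp z.1).card) := by
              generalize (b.comp z.1).card = s
              rw [hpq]; ring
            omega
          · rw [Finset.disjoint_left]
            intro h g1 g2
            simp only [Finset.mem_filter, Finset.mem_product, mem_comp] at g1 g2
            exact hz (g1.2.trans g2.1.symm)
          · simp [hxS, Rel.refl]
          · simp only [Finset.mem_erase, Finset.mem_filter, ne_eq]
            refine ⟨n1, hSv z hz, ?_⟩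
            have := (b.join x z).rel_α x
            rwa [jx] at this
      rw [Finset.sum_congr rfl fun z hz => h1 z (by simpa using hz), Multiset.map_map]
      -- The summand depends only on the component of `z`, and each component is hit by `p` times
      -- its size many half-edges.
      have h2 : (Finset.univ.filter fun z : V × Fin p => ¬ b.Rel x.1 z.1) =
          (b.comps.erase (b.comp x.1)).biUnion fun C => C ×ˢ Finset.univ := by
        ext z
        simp only [Finset.mem_filter, Finset.mem_univ, true_and, Finset.mem_biUnion,
          Finset.mem_product, and_true, Finset.mem_erase]
        constructor
        · intro hz
          exact ⟨b.comp z.1, ⟨fun h => hz (comp_eq_comp_iff.1 h.symm), comp_mem_comps _ _⟩,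
            by simp [Rel.refl]⟩
        · rintro ⟨C, ⟨g1, g2⟩, g3⟩ g4
          rw [eq_comp_of_mem g2 g3] at g1
          exact g1 (comp_eq_comp_iff.2 g4.symm)
      rw [h2, Finset.sum_biUnion]
      · refine Finset.sum_congr rfl fun C hC => ?_
        rw [Finset.mem_erase] at hC
        have h3 : ∀ z ∈ C ×ˢ (Finset.univ : Finset (Fin p)), b.comp z.1 = C := fun z hz =>
          (eq_comp_of_mem hC.2 (Finset.mem_product.1 hz).1).symm
        rw [Finset.sum_congr rfl fun z hz => by rw [h3 z hz], Finset.sum_const,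
          Finset.card_product, Finset.card_univ, Fintype.card_fin, smul_eq_mul,
          Function.comp_apply, Finset.erase_val, Multiset.map_erase_of_mem _ _ (by
            exact Finset.mem_erase.2 hC), mul_comm p]
      · intro C hC D hD hne
        rw [Function.onFun, Finset.disjoint_left]
        intro z g1 g2
        simp only [Finset.coe_erase, Set.mem_sdiff, Finset.mem_coe, Finset.mem_product] at hC hD g1 g2
        exact hne ((eq_comp_of_mem hC.1 g1.1).trans (eq_comp_of_mem hD.1 g2.1).symm)

end Components


/-! ### Renaming, gluing, and the order on disjoint unions -/

theorem relabel_α (b : TraceMap p V) (e : V ≃ W) (v : V) (j : Fin p) :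
    (b.relabel e).α (e v, j) = (e (b.α (v, j)).1, (b.α (v, j)).2) := by
  simp [relabel, Prod.map]

theorem closed_relabel {b : TraceMap p V} {e : V ≃ W} {S : Set W} :
    (b.relabel e).Closed S ↔ b.Closed (e ⁻¹' S) := by
  constructor
  · rintro h ⟨v, j⟩ hv
    have := h (e v, j) hv
    rwa [relabel_α] at this
  · rintro h ⟨w, j⟩ hw
    obtain ⟨v, rfl⟩ := e.surjective w
    rw [relabel_α]
    exact h (v, j) hw

theorem disjUnion_α_inl (b : TraceMap p V) (c : TraceMap p W) (v : V) (j : Fin p) :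
    (b.disjUnion c).α (Sum.inl v, j) = (Sum.inl (b.α (v, j)).1, (b.α (v, j)).2) := by
  simp [disjUnion, Equiv.permCongr_apply]

theorem disjUnion_α_inr (b : TraceMap p V) (c : TraceMap p W) (w : W) (j : Fin p) :
    (b.disjUnion c).α (Sum.inr w, j) = (Sum.inr (c.α (w, j)).1, (c.α (w, j)).2) := by
  simp [disjUnion, Equiv.permCongr_apply]

theorem closed_disjUnion {b : TraceMap p V} {c : TraceMap p W} {S : Set (V ⊕ W)} :
    (b.disjUnion c).Closed S ↔ b.Closed (Sum.inl ⁻¹' S) ∧ c.Closed (Sum.inr ⁻¹' S) := by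
  constructor
  · refine fun h => ⟨?_, ?_⟩
    · rintro ⟨v, j⟩ hv
      have := h (Sum.inl v, j) hv
      rwa [disjUnion_α_inl] at this
    · rintro ⟨v, j⟩ hv
      have := h (Sum.inr v, j) hv
      rwa [disjUnion_α_inr] at this
  · rintro ⟨h1, h2⟩ ⟨v | w, j⟩ hv
    · rw [disjUnion_α_inl]
      exact h1 (v, j) hv
    · rw [disjUnion_α_inr]
      exact h2 (w, j) hv

theorem connected_relabel {b : TraceMap p V} {e : V ≃ W} :
    (b.relabel e).Connected ↔ b.Connected := by
  rw [connected_iff_closed, connected_iff_closed, e.nonempty_congr]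
  refine and_congr_right fun _ => ⟨fun h S hS hne => ?_, fun h S hS hne => ?_⟩
  · have := h (e '' S) (by rw [closed_relabel, e.preimage_image]; exact hS) (hne.image e)
    rw [← e.preimage_image S, this, Set.preimage_univ]
  · have := h _ (closed_relabel.1 hS) (hne.preimage e.surjective)
    rwa [Set.preimage_eq_univ_iff, e.range_eq_univ, Set.univ_subset_iff] at this

/-- Renaming of the vertices as a bijection. -/
def relabelEquiv (e : V ≃ W) : TraceMap p V ≃ TraceMap p W where
  toFun b := b.relabel e
  invFun b := b.relabel e.symm
  left_inv b := by
    ext1; ext1 h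
    simp [relabel, Equiv.permCongr_apply, Prod.map]
  right_inv b := by
    ext1; ext1 h
    simp [relabel, Equiv.permCongr_apply, Prod.map]

theorem SwitchBelow.relabel {b c : TraceMap p V} (h : SwitchBelow b c) (e : V ≃ W) :
    SwitchBelow (b.relabel e) (c.relabel e) := by
  classical
  obtain ⟨⟨x, y, h⟩, hn⟩ := h
  refine ⟨⟨(e x.1, x.2), (e y.1, y.2), ?_⟩, by rw [numComponents_relabel, numComponents_relabel, hn]⟩
  have hs : ∀ k : V × Fin p, Equiv.swap (e x.1, x.2) (e y.1, y.2) (e k.1, k.2) =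
      (e (Equiv.swap x y k).1, (Equiv.swap x y k).2) := by
    intro k
    have := (Equiv.prodCongr e (Equiv.refl (Fin p))).injective.swap_apply x y k
    simpa [Prod.map] using this
  rintro ⟨w, j⟩
  obtain ⟨v, rfl⟩ := e.surjective w
  have h1 := hs (v, j)
  have h2 := hs (b.α (v, j))
  have h3 := h (v, j)
  have h4 : (c.relabel e).α (e (Equiv.swap x y (v, j)).1, (Equiv.swap x y (v, j)).2) =
      (e (c.α (Equiv.swap x y (v, j))).1, (c.α (Equiv.swap x y (v, j))).2) := relabel_α _ _ _ _
  have h5 : c.α (Equiv.swap x y (v, j)) = Equiv.swap x y (b.α (v, j)) := by convert h3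
  rw [h5, ← h2, ← h1, ← relabel_α] at h4
  convert h4

theorem relabel_le {b c : TraceMap p V} (h : b ≤ c) (e : V ≃ W) : b.relabel e ≤ c.relabel e :=
  Relation.ReflTransGen.lift (fun b : TraceMap p V => b.relabel e)
    (fun _ _ h => SwitchBelow.relabel h e) _ _ h

theorem relabel_le_iff {b c : TraceMap p V} (e : V ≃ W) : b.relabel e ≤ c.relabel e ↔ b ≤ c := by
  refine ⟨fun h => ?_, fun h => relabel_le h e⟩
  have := relabel_le h e.symm
  rwa [show (b.relabel e).relabel e.symm = b from (relabelEquiv e).left_inv b,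
    show (c.relabel e).relabel e.symm = c from (relabelEquiv e).left_inv c] at this

section Glue

variable (P : V → Prop) [DecidablePred P]

/-- The map that consists of a map on the vertices in `P` and a map on the other ones. -/
def glue (b : TraceMap p {v // P v}) (c : TraceMap p {v // ¬ P v}) : TraceMap p V :=
  (b.disjUnion c).relabel (Equiv.sumCompl P)

variable {P} {b : TraceMap p {v // P v}} {c : TraceMap p {v // ¬ P v}}

theorem glue_α_pos (v : {v // P v}) (j : Fin p) :
    (glue P b c).α (v.1, j) = ((b.α (v, j)).1.1, (b.α (v, j)).2) := by
  have := relabel_α (b.disjUnion c) (Equiv.sumCompl P) (Sum.inl v) j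
  rw [disjUnion_α_inl] at this
  exact this

theorem glue_α_neg (v : {v // ¬ P v}) (j : Fin p) :
    (glue P b c).α (v.1, j) = ((c.α (v, j)).1.1, (c.α (v, j)).2) := by
  have := relabel_α (b.disjUnion c) (Equiv.sumCompl P) (Sum.inr v) j
  rw [disjUnion_α_inr] at this
  exact this

theorem closed_glue {S : Set V} : (glue P b c).Closed S ↔
    b.Closed {v | v.1 ∈ S} ∧ c.Closed {v | v.1 ∈ S} := by
  rw [glue, closed_relabel, closed_disjUnion]
  rfl

theorem closed_glue_self : (glue P b c).Closed {v | P v} := by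
  rw [closed_glue]
  exact ⟨fun h _ => (b.α h).1.2, fun h hh => absurd hh h.1.2⟩

theorem rel_glue_pos {v w : {v // P v}} : (glue P b c).Rel v.1 w.1 ↔ b.Rel v w := by
  constructor
  · intro h
    have hS : (glue P b c).Closed {u | ∃ h : P u, b.Rel v ⟨u, h⟩} := by
      rw [closed_glue]
      refine ⟨?_, fun k hk => absurd hk.1 k.1.2⟩
      rintro k ⟨hk, hk'⟩
      exact ⟨(b.α k).1.2, hk'.trans (b.rel_α k)⟩
    exact (hS.rel h ⟨v.2, Rel.refl _ _⟩).2
  · intro h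
    rw [rel_iff]
    intro S hS hv
    exact (closed_glue.1 hS).1.rel h hv

theorem rel_glue_neg {v w : {v // ¬ P v}} : (glue P b c).Rel v.1 w.1 ↔ c.Rel v w := by
  constructor
  · intro h
    have hS : (glue P b c).Closed {u | ∃ h : ¬ P u, c.Rel v ⟨u, h⟩} := by
      rw [closed_glue]
      refine ⟨fun k hk => absurd k.1.2 hk.1, ?_⟩
      rintro k ⟨hk, hk'⟩
      exact ⟨(c.α k).1.2, hk'.trans (c.rel_α k)⟩
    exact (hS.rel h ⟨v.2, Rel.refl _ _⟩).2
  · intro h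
    rw [rel_iff]
    intro S hS hv
    exact (closed_glue.1 hS).2.rel h hv

theorem glue_injective {b' : TraceMap p {v // P v}} {c' : TraceMap p {v // ¬ P v}}
    (h : glue P b c = glue P b' c') : b = b' ∧ c = c' := by
  constructor
  · ext1; ext1 ⟨v, j⟩
    have h1 := glue_α_pos (b := b) (c := c) v j
    rw [h, glue_α_pos] at h1
    simp only [Prod.mk.injEq] at h1
    exact Prod.ext (Subtype.ext h1.1.symm) h1.2.symm
  · ext1; ext1 ⟨v, j⟩
    have h1 := glue_α_neg (b := b) (c := c) v j
    rw [h, glue_α_neg] at h1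
    simp only [Prod.mk.injEq] at h1
    exact Prod.ext (Subtype.ext h1.1.symm) h1.2.symm

/-- The restriction of a map to a closed set of vertices. -/
def restrict (d : TraceMap p V) (Q : V → Prop) (hd : d.Closed {v | Q v}) :
    TraceMap p {v // Q v} where
  α :=
    { toFun := fun h => (⟨(d.α (h.1.1, h.2)).1, hd (h.1.1, h.2) h.1.2⟩, (d.α (h.1.1, h.2)).2)
      invFun := fun h => (⟨(d.α (h.1.1, h.2)).1, hd (h.1.1, h.2) h.1.2⟩, (d.α (h.1.1, h.2)).2)
      left_inv := fun h => by simp [d.invol]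
      right_inv := fun h => by simp [d.invol] }
  invol h := by simp [d.invol]
  no_fixed h hh := by
    rw [Prod.ext_iff, Subtype.ext_iff] at hh
    exact d.no_fixed (h.1.1, h.2) (Prod.ext hh.1 hh.2)

theorem exists_glue {d : TraceMap p V} (hd : d.Closed {v | P v}) : ∃ b c, d = glue P b c := by
  refine ⟨d.restrict P hd, d.restrict (fun v => ¬ P v) hd.compl, ?_⟩
  ext1; ext1 ⟨v, j⟩
  by_cases hv : P v
  · exact (glue_α_pos (b := d.restrict P hd) ⟨v, hv⟩ j).symm
  · exact (glue_α_neg (c := d.restrict (fun v => ¬ P v) hd.compl) ⟨v, hv⟩ j).symm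

theorem exch_glue_pos (x y : {v // P v} × Fin p) :
    (glue P b c).exch (x.1.1, x.2) (y.1.1, y.2) = glue P (b.exch x y) c := by
  classical
  let f : {v // P v} × Fin p → V × Fin p := fun h => (h.1.1, h.2)
  have hf : Function.Injective f := fun h k hk => by
    simp only [f, Prod.mk.injEq] at hk
    exact Prod.ext (Subtype.ext hk.1) hk.2
  have hg : ∀ (b : TraceMap p {v // P v}) k, (glue P b c).α (f k) = f (b.α k) :=
    fun b k => glue_α_pos k.1 k.2
  ext1; ext1 ⟨v, j⟩
  by_cases hv : P v
  · change ((glue P b c).exch (f x) (f y)).α (f (⟨v, hv⟩, j)) =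
      (glue P (b.exch x y) c).α (f (⟨v, hv⟩, j))
    rw [hg, exch_α, exch_α, hf.swap_apply, hg, hf.swap_apply]
    convert rfl
  · have hs : ∀ k : V × Fin p, ¬ P k.1 → Equiv.swap (f x) (f y) k = k := by
      intro k hk
      refine Equiv.swap_apply_of_ne_of_ne ?_ ?_
      · rintro rfl
        exact hk x.1.2
      · rintro rfl
        exact hk y.1.2
    change ((glue P b c).exch (f x) (f y)).α _ = _
    rw [exch_α, hs (v, j) hv, hs, glue_α_neg ⟨v, hv⟩, glue_α_neg ⟨v, hv⟩]
    rw [glue_α_neg ⟨v, hv⟩]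
    exact (c.α (⟨v, hv⟩, j)).1.2

theorem exch_glue_neg (x y : {v // ¬ P v} × Fin p) :
    (glue P b c).exch (x.1.1, x.2) (y.1.1, y.2) = glue P b (c.exch x y) := by
  classical
  let f : {v // ¬ P v} × Fin p → V × Fin p := fun h => (h.1.1, h.2)
  have hf : Function.Injective f := fun h k hk => by
    simp only [f, Prod.mk.injEq] at hk
    exact Prod.ext (Subtype.ext hk.1) hk.2
  have hg : ∀ (c : TraceMap p {v // ¬ P v}) k, (glue P b c).α (f k) = f (c.α k) :=
    fun b k => glue_α_neg k.1 k.2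
  ext1; ext1 ⟨v, j⟩
  by_cases hv : P v
  · have hs : ∀ k : V × Fin p, P k.1 → Equiv.swap (f x) (f y) k = k := by
      intro k hk
      refine Equiv.swap_apply_of_ne_of_ne ?_ ?_
      · rintro rfl
        exact x.1.2 hk
      · rintro rfl
        exact y.1.2 hk
    change ((glue P b c).exch (f x) (f y)).α _ = _
    rw [exch_α, hs (v, j) hv, hs, glue_α_pos ⟨v, hv⟩, glue_α_pos ⟨v, hv⟩]
    rw [glue_α_pos ⟨v, hv⟩]
    exact (b.α (⟨v, hv⟩, j)).1.2
  · change ((glue P b c).exch (f x) (f y)).α (f (⟨v, hv⟩, j)) =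
      (glue P b (c.exch x y)).α (f (⟨v, hv⟩, j))
    rw [hg, exch_α, exch_α, hf.swap_apply, hg, hf.swap_apply]
    convert rfl

theorem glue_le_glue [Finite V] (hp : Even p) {b' : TraceMap p {v // P v}}
    {c' : TraceMap p {v // ¬ P v}} (hb : b ≤ b') (hc : c ≤ c') : glue P b c ≤ glue P b' c' := by
  refine le_trans (b := glue P b' c) ?_ ?_
  · rw [le_iff_merge hp] at hb ⊢
    refine Relation.ReflTransGen.lift (fun b => glue P b c) ?_ _ _ hb
    rintro b b' ⟨x, y, hxy, rfl⟩
    exact ⟨(x.1.1, x.2), (y.1.1, y.2), fun h => hxy (rel_glue_pos.1 h), (exch_glue_pos x y).symm⟩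
  · rw [le_iff_merge hp] at hc ⊢
    refine Relation.ReflTransGen.lift (fun c => glue P b' c) ?_ _ _ hc
    rintro c c' ⟨x, y, hxy, rfl⟩
    exact ⟨(x.1.1, x.2), (y.1.1, y.2), fun h => hxy (rel_glue_neg.1 h), (exch_glue_neg x y).symm⟩

/-- The vertex set `P` is closed after the merging, hence closed before it and not separating the
two ends; the merging takes place on one side. -/
theorem exists_of_merge_glue [Finite V] (hp : Even p) {d : TraceMap p V}
    (h : Merge d (glue P b c)) : ∃ b' c', b' ≤ b ∧ c' ≤ c ∧ d = glue P b' c' := by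
  have hd : d.Closed {v | P v} := by
    obtain ⟨x, y, hxy, h⟩ := h
    have := closed_glue_self (P := P) (b := b) (c := c)
    rw [h] at this
    exact ((closed_exch_iff hp hxy).1 this).1
  obtain ⟨b', c', rfl⟩ := exists_glue hd
  obtain ⟨x, y, hxy, h⟩ := h
  have h1 : P x.1 ↔ P y.1 := by
    have := closed_glue_self (P := P) (b := b) (c := c)
    rw [h] at this
    exact ((closed_exch_iff hp hxy).1 this).2
  by_cases hx : P x.1
  · have h2 := exch_glue_pos (b := b') (c := c') (⟨x.1, hx⟩, x.2) (⟨y.1, h1.1 hx⟩, y.2)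
    obtain ⟨rfl, rfl⟩ := glue_injective (h.trans h2)
    refine ⟨b', c, ?_, le_rfl, rfl⟩
    exact Merge.le hp ⟨_, _, fun h' => hxy (rel_glue_pos.2 h'), rfl⟩
  · have h2 := exch_glue_neg (b := b') (c := c') (⟨x.1, hx⟩, x.2) (⟨y.1, mt h1.2 hx⟩, y.2)
    obtain ⟨rfl, rfl⟩ := glue_injective (h.trans h2)
    refine ⟨b, c', le_rfl, ?_, rfl⟩
    exact Merge.le hp ⟨_, _, fun h' => hxy (rel_glue_neg.2 h'), rfl⟩

/-- The lower set of a disjoint union is the product of the lower sets of its parts. This is what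
makes cumulants multiplicative. -/
theorem le_glue_iff [Finite V] (hp : Even p) {d : TraceMap p V} :
    d ≤ glue P b c ↔ ∃ b' c', b' ≤ b ∧ c' ≤ c ∧ d = glue P b' c' := by
  constructor
  · intro h
    rw [le_iff_merge hp] at h
    induction h using Relation.ReflTransGen.head_induction_on with
    | refl => exact ⟨b, c, le_rfl, le_rfl, rfl⟩
    | head h _ ih =>
      obtain ⟨b', c', hb, hc, rfl⟩ := ih
      obtain ⟨b'', c'', hb', hc', rfl⟩ := exists_of_merge_glue hp h
      exact ⟨b'', c'', hb'.trans hb, hc'.trans hc, rfl⟩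
  · rintro ⟨b', c', hb, hc, rfl⟩
    exact glue_le_glue hp hb hc

theorem comp_glue_neg [Fintype V] (v : {v // ¬ P v}) :
    (glue P b c).comp v.1 = (c.comp v).map (Function.Embedding.subtype _) := by
  ext w
  simp only [mem_comp, Finset.mem_map, Function.Embedding.subtype_apply]
  constructor
  · intro h
    have hw : ¬ P w := (closed_glue_self (b := b) (c := c)).compl.rel h v.2
    exact ⟨⟨w, hw⟩, rel_glue_neg.1 h, rfl⟩
  · rintro ⟨u, hu, rfl⟩
    exact rel_glue_neg.2 hu

theorem mem_comps_glue [Fintype V] {C : Finset V} {b : TraceMap p {v // v ∈ C}}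
    {c : TraceMap p {v // ¬ v ∈ C}} [DecidablePred fun v => v ∈ C] :
    C ∈ (glue (fun v => v ∈ C) b c).comps ↔ b.Connected := by
  rw [mem_comps, connected_iff_rel]
  constructor
  · rintro ⟨u, hu⟩
    have huC : u ∈ C := by rw [← hu, mem_comp]; exact Rel.refl _ _
    have h : ∀ v : {v // v ∈ C}, b.Rel ⟨u, huC⟩ v := by
      intro v
      have hv : v.1 ∈ (glue (fun v => v ∈ C) b c).comp u := (Finset.ext_iff.1 hu v.1).2 v.2
      exact rel_glue_pos.1 (mem_comp.1 hv)
    exact ⟨fun v w => (h v).symm.trans (h w), ⟨⟨u, huC⟩⟩⟩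
  · rintro ⟨h, ⟨u⟩⟩
    refine ⟨u.1, ?_⟩
    ext w
    rw [mem_comp]
    constructor
    · intro hw
      exact (closed_glue_self (P := fun v => v ∈ C) (b := b) (c := c)).rel hw u.2
    · intro hw
      exact rel_glue_pos.2 (h u ⟨w, hw⟩)

theorem closed_of_mem_comps [Fintype V] {d : TraceMap p V} {C : Finset V} (hC : C ∈ d.comps) :
    d.Closed {v | v ∈ C} := by
  obtain ⟨u, rfl⟩ := mem_comps.1 hC
  intro h hh
  have hh' : d.Rel u h.1 := mem_comp.1 hh
  exact mem_comp.2 (hh'.trans (d.rel_α h))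

theorem sizes_glue_erase [Fintype V] {C : Finset V} {b : TraceMap p {v // v ∈ C}}
    {c : TraceMap p {v // ¬ v ∈ C}} [DecidablePred fun v => v ∈ C] (hb : b.Connected) :
    (glue (fun v => v ∈ C) b c).sizes.erase C.card = c.sizes := by
  classical
  have hC := mem_comps_glue (c := c).2 hb
  rw [← sizes_erase hC]
  have h1 : (glue (fun v => v ∈ C) b c).comps.erase C =
      c.comps.map ⟨Finset.map (Function.Embedding.subtype _), Finset.map_injective _⟩ := by
    ext D
    simp only [Finset.mem_erase, Finset.mem_map, Function.Embedding.coeFn_mk]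
    constructor
    · rintro ⟨hne, hD⟩
      obtain ⟨v, rfl⟩ := mem_comps.1 hD
      have hv : v ∉ C := fun hv => hne (eq_comp_of_mem hC hv).symm
      exact ⟨c.comp ⟨v, hv⟩, comp_mem_comps _ _, (comp_glue_neg ⟨v, hv⟩).symm⟩
    · rintro ⟨D, hD, rfl⟩
      obtain ⟨v, rfl⟩ := mem_comps.1 hD
      rw [← comp_glue_neg (b := b) (c := c)]
      refine ⟨fun h => v.2 ?_, comp_mem_comps _ _⟩
      have hv : v.1 ∈ (glue (fun v => v ∈ C) b c).comp v.1 := mem_comp.2 (Rel.refl _ _)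
      exact (Finset.ext_iff.1 h v.1).1 hv
  rw [h1, Finset.map_val, Multiset.map_map, sizes]
  refine Multiset.map_congr rfl fun D _ => ?_
  simp

end Glue

end TraceMap

/-! ### Multiplicativity and linearity of the cumulants -/

namespace TensorDistribution

variable {p : ℕ} {E : Type*} [AddCommGroup E] [Module ℝ E] (φ : TensorDistribution p E)

open Classical in
theorem cumulant_def {V : Type} [Finite V] (T : V → E) (b : TraceMap p V) :
    φ.cumulant T b = φ.val b T - ∑ b' : {b' : TraceMap p V // b' < b}, φ.cumulant T b'.1 := by
  rw [cumulant]

/-- Values are multiplicative and lower sets are products, so both sides have the same sums over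
lower sets; by induction all terms but the top one cancel. -/
theorem cumulant_glue {V : Type} [Finite V] (hp : Even p) {P : V → Prop} [DecidablePred P]
    (T : V → E) (b : TraceMap p {v // P v}) : ∀ c : TraceMap p {v // ¬ P v},
    φ.cumulant T (TraceMap.glue P b c) =
      φ.cumulant (fun v => T v.1) b * φ.cumulant (fun v => T v.1) c := by
  classical
  induction b using WellFoundedLT.induction with
  | _ b ihb =>
  intro c
  induction c using WellFoundedLT.induction with
  | _ c ihc =>
  have h1 : φ.val (TraceMap.glue P b c) T =
      φ.val b (fun v => T v.1) * φ.val c (fun v => T v.1) := by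
    rw [TraceMap.glue, φ.val_relabel, φ.val_disjUnion]
    rfl
  rw [φ.val_eq_sum_cumulant, φ.val_eq_sum_cumulant, φ.val_eq_sum_cumulant, Finset.sum_mul_sum,
    ← Finset.sum_product'] at h1
  have h2 : ∑ d : TraceMap p V with d ≤ TraceMap.glue P b c, φ.cumulant T d =
      ∑ x ∈ (Finset.univ.filter (· ≤ b)) ×ˢ (Finset.univ.filter (· ≤ c)),
        φ.cumulant T (TraceMap.glue P x.1 x.2) := by
    symm
    refine Finset.sum_bij (fun x _ => TraceMap.glue P x.1 x.2) ?_ ?_ ?_ ?_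
    · intro x hx
      simp only [Finset.mem_product, Finset.mem_filter, Finset.mem_univ, true_and] at hx ⊢
      exact TraceMap.glue_le_glue hp hx.1 hx.2
    · intro x _ y _ h
      obtain ⟨g1, g2⟩ := TraceMap.glue_injective h
      exact Prod.ext g1 g2
    · intro d hd
      simp only [Finset.mem_filter, Finset.mem_univ, true_and] at hd
      obtain ⟨b', c', hb, hc, rfl⟩ := (TraceMap.le_glue_iff hp).1 hd
      exact ⟨(b', c'), by simp [hb, hc], rfl⟩
    · intro x _
      rfl
  have hmem : (b, c) ∈ (Finset.univ.filter (· ≤ b)) ×ˢ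
      (Finset.univ.filter (· ≤ c) : Finset (TraceMap p {v // ¬ P v})) := by simp
  rw [h2, ← Finset.sum_erase_add _ _ hmem, ← Finset.sum_erase_add _ _ hmem] at h1
  have h3 : ∀ x ∈ ((Finset.univ.filter (· ≤ b)) ×ˢ
      (Finset.univ.filter (· ≤ c) : Finset (TraceMap p {v // ¬ P v}))).erase (b, c),
      φ.cumulant T (TraceMap.glue P x.1 x.2) =
        φ.cumulant (fun v => T v.1) x.1 * φ.cumulant (fun v => T v.1) x.2 := by
    rintro ⟨b', c'⟩ hx
    simp only [Finset.mem_erase, Finset.mem_product, Finset.mem_filter, Finset.mem_univ, true_and,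
      ne_eq, Prod.mk.injEq] at hx
    obtain ⟨hne, hb, hc⟩ := hx
    rcases hb.lt_or_eq with hb' | rfl
    · exact ihb b' hb' c'
    · exact ihc c' (lt_of_le_of_ne hc fun h => hne ⟨rfl, h⟩)
  rw [Finset.sum_congr rfl h3] at h1
  exact add_left_cancel h1

theorem cumulant_relabel {V W : Type} [Finite V] [Finite W] (e : V ≃ W) (T : W → E)
    (b : TraceMap p V) :
    φ.cumulant T (b.relabel e) = φ.cumulant (fun v => T (e v)) b := by
  classical
  induction b using WellFoundedLT.induction with
  | _ b ih =>
  rw [cumulant_def, cumulant_def, φ.val_relabel]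
  congr 1
  symm
  have h : ∀ b' : TraceMap p V, b' < b ↔ b'.relabel e < b.relabel e := by
    intro b'
    rw [lt_iff_le_not_ge, lt_iff_le_not_ge, TraceMap.relabel_le_iff, TraceMap.relabel_le_iff]
  refine Fintype.sum_equiv ((TraceMap.relabelEquiv e).subtypeEquiv h) _ _ fun b' => ?_
  exact (ih b'.1 b'.2).symm

/-- Möbius inversion has coefficients that do not depend on the tensors, so a linear relation
between the values at all maps passes to the cumulants. It is used for the multilinear expansion of
a sum of tensors. -/
theorem cumulant_eq_sum {V ι : Type} [Finite V] (s : Finset ι) (a : ι → ℝ) (T : V → E)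
    (T' : ι → V → E) (h : ∀ b : TraceMap p V, φ.val b T = ∑ i ∈ s, a i * φ.val b (T' i))
    (b : TraceMap p V) : φ.cumulant T b = ∑ i ∈ s, a i * φ.cumulant (T' i) b := by
  classical
  induction b using WellFoundedLT.induction with
  | _ b ih =>
  rw [cumulant_def, h, Finset.sum_congr rfl fun b' : {b' // b' < b} => fun _ => ih b'.1 b'.2,
    Finset.sum_comm, ← Finset.sum_sub_distrib]
  refine Finset.sum_congr rfl fun i _ => ?_
  rw [φ.cumulant_def (T' i) b, mul_sub, Finset.mul_sum]

open Classical in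
/-- The sum of the cumulants of all connected maps on the vertices `V`. -/
noncomputable def connSum (V : Type) [Finite V] (T : E) : ℝ :=
  ∑ b : TraceMap p V with b.Connected, φ.cumulant (fun _ => T) b

theorem connSum_congr {V W : Type} [Finite V] [Finite W] (e : V ≃ W) (T : E) :
    φ.connSum V T = φ.connSum W T := by
  classical
  rw [connSum, connSum, Finset.sum_filter, Finset.sum_filter]
  refine Fintype.sum_equiv (TraceMap.relabelEquiv e) _ _ fun b => ?_
  change _ = if (b.relabel e).Connected then φ.cumulant _ (b.relabel e) else 0
  simp only [TraceMap.connected_relabel, φ.cumulant_relabel e]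

/-- The sum of the cumulants of all connected maps on `n` vertices. -/
noncomputable def freeCumulant (n : ℕ) (T : E) : ℝ := φ.connSum (Fin n) T

theorem connSum_eq {V : Type} [Fintype V] (T : E) :
    φ.connSum V T = φ.freeCumulant (Fintype.card V) T :=
  φ.connSum_congr (Fintype.equivFin V) T

open Classical in
/-- A sum over maps with a distinguished component factorizes. -/
theorem sum_cumulant_comps {V : Type} [Fintype V] (hp : Even p) (T : E)
    (g : ℕ → Multiset ℕ → ℝ) :
    ∑ b : TraceMap p V, φ.cumulant (fun _ => T) b *
        ∑ C ∈ b.comps, g C.card (b.sizes.erase C.card) =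
      ∑ C : Finset V, φ.freeCumulant C.card T *
        ∑ c : TraceMap p {v // ¬ v ∈ C}, φ.cumulant (fun _ => T) c * g C.card c.sizes := by
  have h1 : ∀ b : TraceMap p V, φ.cumulant (fun _ => T) b *
        ∑ C ∈ b.comps, g C.card (b.sizes.erase C.card) =
      ∑ C : Finset V, if C ∈ b.comps then
        φ.cumulant (fun _ => T) b * g C.card (b.sizes.erase C.card) else 0 := by
    intro b
    rw [Finset.mul_sum, ← Finset.sum_filter]
    congr 1
    ext C
    simp
  rw [Finset.sum_congr rfl fun b _ => h1 b, Finset.sum_comm]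
  refine Finset.sum_congr rfl fun C _ => ?_
  have h2 : φ.freeCumulant C.card T = φ.connSum {v // v ∈ C} T := by
    rw [connSum_eq, Fintype.card_coe]
  rw [h2, connSum, ← Finset.sum_filter, Finset.sum_mul_sum, ← Finset.sum_product']
  symm
  -- A map having `C` as a component is a connected map on `C` glued to an arbitrary map on the
  -- complement.
  refine Finset.sum_bij (fun x _ => TraceMap.glue (fun v => v ∈ C) x.1 x.2) ?_ ?_ ?_ ?_
  · intro x hx
    simp only [Finset.mem_product, Finset.mem_filter, Finset.mem_univ, true_and, and_true] at hx ⊢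
    exact TraceMap.mem_comps_glue.2 hx
  · intro x _ y _ h
    obtain ⟨g1, g2⟩ := TraceMap.glue_injective h
    exact Prod.ext g1 g2
  · intro d hd
    simp only [Finset.mem_filter, Finset.mem_univ, true_and] at hd
    obtain ⟨b', c', rfl⟩ := TraceMap.exists_glue (P := fun v => v ∈ C)
      (TraceMap.closed_of_mem_comps hd)
    exact ⟨(b', c'), by simpa using TraceMap.mem_comps_glue.1 hd, rfl⟩
  · intro x hx
    simp only [Finset.mem_product, Finset.mem_filter, Finset.mem_univ, true_and, and_true] at hx
    rw [φ.cumulant_glue hp, TraceMap.sizes_glue_erase hx, mul_assoc]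

end TensorDistribution

/-! ### The functional equation between moments and cumulants -/

/-- The solution of the recursion for the generating function `M ^ a`, where
`M = 1 + ∑_s p * s * K_s / s! * z ^ s * M ^ (q * s)`. -/
noncomputable def cumulantPoly (p q : ℕ) (K : ℕ → ℝ) : ℕ → ℕ → ℝ
  | 0, n => if n = 0 then 1 else 0
  | a + 1, n => cumulantPoly p q K a n +
      ∑ s : Fin n, (n.choose (s + 1) : ℝ) * (K (s + 1) * ((p * (s + 1) : ℕ) *
        cumulantPoly p q K (a + q * (s + 1)) (n - 1 - s)))
termination_by a n => (n, a)

namespace TensorDistribution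

variable {p : ℕ} {E : Type*} [AddCommGroup E] [Module ℝ E] (φ : TensorDistribution p E)

open Classical in
-- Summing `mergeCount_succ` against the cumulants, the block that is merged next splits off as a
-- factor `K_s`; the `n.choose s` positions of this block give the recursion of `cumulantPoly`.
theorem sum_cumulant_mergeCount {q : ℕ} (hp : Even p) (T : E) (n : ℕ) :
    ∀ (a : ℕ) (V : Type) [Fintype V], Fintype.card V = n →
    ∑ b : TraceMap p V, φ.cumulant (fun _ => T) b * (mergeCount p q a b.sizes : ℝ) =
      cumulantPoly p q (fun s => φ.freeCumulant s T) a n := by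
  induction n using Nat.strong_induction_on with
  | _ n ihn =>
  intro a
  induction a with
  | zero =>
    intro V _ hV
    rw [cumulantPoly]
    split_ifs with hn
    · rw [hn, Fintype.card_eq_zero_iff] at hV
      have h0 : ∀ b : TraceMap p V, b.sizes = 0 := by
        intro b
        simp [TraceMap.sizes, TraceMap.comps]
      have h1 : Subsingleton (TraceMap p V) :=
        ⟨fun b c => TraceMap.ext (Equiv.ext fun h => hV.elim h.1)⟩
      let b0 : TraceMap p V := ⟨1, fun h => hV.elim h.1, fun h => hV.elim h.1⟩
      have h2 : Finset.univ = {b0} := by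
        ext b
        simp [Subsingleton.elim b b0]
      rw [h2, Finset.sum_singleton, h0, mergeCount_nil, Nat.cast_one, mul_one, cumulant_def,
        φ.val_empty, Finset.sum_eq_zero, sub_zero]
      intro b' _
      exact absurd (Subsingleton.elim b'.1 b0) b'.2.ne
    · refine Finset.sum_eq_zero fun b _ => ?_
      have : Nonempty V := by
        rw [← Fintype.card_pos_iff]
        omega
      obtain ⟨v⟩ := this
      rw [mergeCount_zero, Nat.cast_zero, mul_zero]
      rw [TraceMap.sizes, Ne, Multiset.map_eq_zero, Finset.val_eq_zero]
      exact Finset.ne_empty_of_mem (TraceMap.comp_mem_comps b v)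
  | succ a iha =>
    intro V _ hV
    have h1 : ∀ b : TraceMap p V, (mergeCount p q (a + 1) b.sizes : ℝ) = mergeCount p q a b.sizes +
        ∑ C ∈ b.comps, ((p * C.card : ℕ) : ℝ) *
          (mergeCount p q (a + q * C.card) (b.sizes.erase C.card) : ℝ) := by
      intro b
      rw [mergeCount_succ, Nat.cast_add]
      congr 1
      conv_lhs => enter [1, 1, 2]; rw [TraceMap.sizes]
      rw [Multiset.map_map]
      rw [← Finset.sum_eq_multiset_sum, Nat.cast_sum]
      refine Finset.sum_congr rfl fun C _ => ?_
      simp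
    simp only [h1, mul_add, Finset.sum_add_distrib]
    rw [iha V hV, φ.sum_cumulant_comps hp T fun s M =>
      ((p * s : ℕ) : ℝ) * (mergeCount p q (a + q * s) M : ℝ), cumulantPoly]
    congr 1
    -- The empty set drops out through the factor `p * C.card`; for the others the complement is
    -- smaller than `n` and the induction applies.
    have h2 : ∀ C : Finset V, φ.freeCumulant C.card T *
        ∑ c : TraceMap p {v // ¬ v ∈ C}, φ.cumulant (fun _ => T) c * (((p * C.card : ℕ) : ℝ) *
          (mergeCount p q (a + q * C.card) c.sizes : ℝ)) =
        if C.card = 0 then 0 else φ.freeCumulant C.card T * (((p * C.card : ℕ) : ℝ) *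
          cumulantPoly p q (fun s => φ.freeCumulant s T) (a + q * C.card) (n - C.card)) := by
      intro C
      split_ifs with hC
      · simp [hC]
      · have hCn : C.card ≤ n := hV ▸ Finset.card_le_univ C
        rw [← ihn (n - C.card) (by omega) (a + q * C.card) {v // ¬ v ∈ C} (by
          rw [Fintype.card_subtype_compl, Fintype.card_coe, hV])]
        congr 1
        rw [Finset.mul_sum]
        refine Finset.sum_congr rfl fun c _ => ?_
        ring
    rw [Finset.sum_congr rfl fun C _ => h2 C, ← Finset.powerset_univ,
      Finset.sum_powerset_apply_card (fun s => if s = 0 then (0 : ℝ) else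
        φ.freeCumulant s T * (((p * s : ℕ) : ℝ) *
          cumulantPoly p q (fun s => φ.freeCumulant s T) (a + q * s) (n - s))),
      Finset.card_univ, hV, Finset.sum_range_succ', Finset.sum_range]
    simp only [Nat.add_eq_zero_iff, one_ne_zero, and_false, if_false, if_true, smul_zero, add_zero,
      nsmul_eq_mul]
    refine Finset.sum_congr rfl fun s _ => ?_
    rw [Nat.sub_sub, add_comm 1]

open Classical in
-- The factor `card V * p` chooses a root half-edge. A root amounts to a single virtual free edge
-- that is joined to one of the half-edges of `b`, which is why `a = 1` appears.
theorem sum_val_connected {V : Type} [Fintype V] {q : ℕ} (hpq : p = 2 * q) (T : E)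
    (hV : 0 < Fintype.card V) :
    (Fintype.card V * p : ℕ) * ∑ b : TraceMap p V with b.Connected, φ.val b (fun _ => T) =
      cumulantPoly p q (fun s => φ.freeCumulant s T) 1 (Fintype.card V) := by
  have hp : Even p := hpq ▸ even_two_mul q
  rw [← φ.sum_cumulant_mergeCount hp T _ 1 V rfl]
  have h1 : ∑ b : TraceMap p V with b.Connected, φ.val b (fun _ => T) =
      ∑ b : TraceMap p V, φ.cumulant (fun _ => T) b * (b.upCount Finset.univ : ℝ) := by
    simp only [φ.val_eq_sum_cumulant, TraceMap.upCount, Finset.mem_univ, not_true_eq_false,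
      IsEmpty.forall_iff, implies_true, and_true]
    rw [Finset.sum_comm' (s' := fun c : TraceMap p V =>
      Finset.univ.filter fun b => c ≤ b ∧ b.Connected) (t' := Finset.univ)]
    · refine Finset.sum_congr rfl fun c _ => ?_
      rw [Finset.sum_const, nsmul_eq_mul, mul_comm]
    · intro b c
      simp [and_comm]
  rw [h1, Finset.mul_sum]
  refine Finset.sum_congr rfl fun b _ => ?_
  rw [mul_left_comm]
  congr 1
  -- The exploration may start at any vertex `v`, with all `q * s` edges of its component free.
  have h2 : ∀ v : V, b.upCount Finset.univ =
      mergeCount p q (q * (b.comp v).card) (b.sizes.erase (b.comp v).card) := by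
    intro v
    rw [← TraceMap.sizes_erase (TraceMap.comp_mem_comps b v)]
    refine TraceMap.upCount_eq_mergeCount hpq _ _ b _ v le_rfl (by simp) (by simp) ?_
    have : (Finset.univ.filter fun h : V × Fin p => b.Rel v h.1) = b.comp v ×ˢ Finset.univ := by
      ext h
      simp
    rw [this, Finset.card_product, Finset.card_univ, Fintype.card_fin]
    generalize (b.comp v).card = s
    rw [hpq]
    ring
  have h3 : mergeCount p q 0 b.sizes = 0 := by
    rw [mergeCount_zero]
    obtain ⟨v⟩ := Fintype.card_pos_iff.1 hV
    rw [TraceMap.sizes, Ne, Multiset.map_eq_zero, Finset.val_eq_zero]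
    exact Finset.ne_empty_of_mem (TraceMap.comp_mem_comps b v)
  rw [← Nat.cast_mul, show (1 : ℕ) = 0 + 1 from rfl, mergeCount_succ, h3, zero_add]
  congr 1
  conv_rhs => enter [1, 2]; rw [TraceMap.sizes]
  rw [Multiset.map_map]
  change _ = ∑ C ∈ b.comps, _
  have h4 : Fintype.card V = ∑ C ∈ b.comps, C.card := by
    have : (Finset.univ : Finset V) = b.comps.biUnion id := by
      ext v
      simp only [Finset.mem_univ, Finset.mem_biUnion, id, true_iff]
      exact ⟨b.comp v, TraceMap.comp_mem_comps b v, TraceMap.mem_comp.2 (TraceMap.Rel.refl b v)⟩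
    rw [← Finset.card_univ, this, Finset.card_biUnion]
    · rfl
    · intro C hC D hD hne
      rw [Function.onFun, Finset.disjoint_left]
      intro v g1 g2
      exact hne ((TraceMap.eq_comp_of_mem hC g1).trans (TraceMap.eq_comp_of_mem hD g2).symm)
  rw [h4, Finset.sum_mul, Finset.sum_mul]
  refine Finset.sum_congr rfl fun C hC => ?_
  obtain ⟨v, rfl⟩ := TraceMap.mem_comps.1 hC
  rw [h2 v, Function.comp_apply, zero_add, mul_comm p]

end TensorDistribution

/-! ### From labelled to rooted unlabelled maps -/

namespace TraceMap

variable {p n : ℕ} {V : Type}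

theorem rot_apply {p : ℕ} (v : V) (j : Fin (p + 1)) : rot (p + 1) V (v, j) = (v, j + 1) := by
  simp [rot]

theorem map_eq_of_commute {p : ℕ} {f : V × Fin (p + 1) → V × Fin (p + 1)}
    (hf : ∀ h, f (rot (p + 1) V h) = rot (p + 1) V (f h)) (v : V) (j : Fin (p + 1)) :
    f (v, j) = ((f (v, 0)).1, (f (v, 0)).2 + j) := by
  induction j using Fin.induction with
  | zero => simp
  | succ j ih =>
    have h1 := hf (v, j.castSucc)
    rw [ih, rot_apply, rot_apply, Fin.coeSucc_eq_succ] at h1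
    rw [h1, add_assoc, Fin.coeSucc_eq_succ]

open Classical in
/-- The number of permutations of the half-edges that respect the rotation. -/
theorem card_commute_rot {p : ℕ} (hp : 1 ≤ p) (n : ℕ) :
    Fintype.card {σ : Equiv.Perm (Fin n × Fin p) //
      ∀ h, σ (rot p (Fin n) h) = rot p (Fin n) (σ h)} = n.factorial * p ^ n := by
  obtain ⟨p, rfl⟩ := Nat.exists_eq_add_of_le' hp
  -- Such a permutation is a permutation of the vertices together with an independent rotation at
  -- each vertex.
  let g : Equiv.Perm (Fin n) × (Fin n → Fin (p + 1)) →
      {σ : Equiv.Perm (Fin n × Fin (p + 1)) //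
        ∀ h, σ (rot (p + 1) (Fin n) h) = rot (p + 1) (Fin n) (σ h)} := fun x =>
    ⟨{ toFun := fun h => (x.1 h.1, x.2 h.1 + h.2)
       invFun := fun h => (x.1.symm h.1, h.2 - x.2 (x.1.symm h.1))
       left_inv := fun h => by simp
       right_inv := fun h => by simp }, by
      rintro ⟨v, j⟩
      simp [rot_apply, add_assoc]⟩
  have hg : Function.Bijective g := by
    constructor
    · rintro ⟨τ, t⟩ ⟨τ', t'⟩ h
      have h1 : ∀ v, (τ v, t v) = (τ' v, t' v) := by
        intro v
        have := congrArg (fun σ => σ.1 (v, 0)) h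
        simpa [g] using this
      simp only [Prod.mk.injEq] at h1 ⊢
      exact ⟨Equiv.ext fun v => (h1 v).1, funext fun v => (h1 v).2⟩
    · rintro ⟨σ, hσ⟩
      have h1 := map_eq_of_commute (f := σ) hσ
      have h2 : Function.Injective fun v => (σ (v, 0)).1 := by
        intro v w hvw
        simp only at hvw
        have h3 : σ (v, (σ (w, 0)).2 - (σ (v, 0)).2) = σ (w, 0) := by
          rw [h1, hvw]
          simp
        exact congrArg Prod.fst (σ.injective h3)
      refine ⟨(Equiv.ofBijective _ (Finite.injective_iff_bijective.1 h2), fun v => (σ (v, 0)).2), ?_⟩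
      refine Subtype.ext (Equiv.ext ?_)
      rintro ⟨v, j⟩
      exact (h1 v j).symm
  rw [← Fintype.card_of_bijective hg, Fintype.card_prod, Fintype.card_perm, Fintype.card_fun,
    Fintype.card_fin, Fintype.card_fin]

/-- Connectedness as transitivity on half-edges. In this form it is invariant under all permutations
commuting with the rotation, not only renamings of vertices. -/
theorem connected_iff_halfEdges {p : ℕ} (hp : 1 ≤ p) {b : TraceMap p V} [Nonempty V] :
    b.Connected ↔ ∀ A : Set (V × Fin p), (∀ h ∈ A, rot p V h ∈ A) → (∀ h ∈ A, b.α h ∈ A) →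
      A.Nonempty → A = Set.univ := by
  obtain ⟨p, rfl⟩ := Nat.exists_eq_add_of_le' hp
  rw [connected_iff_closed]
  constructor
  · rintro ⟨-, h⟩ A h1 h2 ⟨⟨v, i⟩, hA⟩
    have h3 : ∀ v i j, (v, i) ∈ A → (v, i + j) ∈ A := by
      intro v i j hi
      induction j using Fin.induction with
      | zero => simpa using hi
      | succ j ih =>
        have := h1 _ ih
        rwa [rot_apply, add_assoc, Fin.coeSucc_eq_succ] at this
    have h4 : ∀ v i j, (v, i) ∈ A → (v, j) ∈ A := by
      intro v i j hi
      simpa using h3 v i (j - i) hi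
    have h5 := h {v | (v, 0) ∈ A} ?_ ⟨v, h4 v i 0 hA⟩
    · refine Set.eq_univ_of_forall fun k => ?_
      have : k.1 ∈ {v | (v, 0) ∈ A} := by rw [h5]; trivial
      exact h4 _ _ _ this
    · intro k hk
      exact h4 _ _ _ (h2 k (h4 _ _ _ hk))
  · refine fun h => ⟨inferInstance, fun S hS hne => ?_⟩
    obtain ⟨v, hv⟩ := hne
    have := h {k | k.1 ∈ S} (fun k hk => hk) hS ⟨(v, 0), hv⟩
    refine Set.eq_univ_of_forall fun w => ?_
    have hw : (w, (0 : Fin (p + 1))) ∈ {k : V × Fin (p + 1) | k.1 ∈ S} := by rw [this]; trivial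
    exact hw

end TraceMap

namespace LabelledRootedMap

variable {p n : ℕ}

/-- The image of a rooted map under a permutation of the half-edges that respects the rotation. -/
def act (hp : 1 ≤ p) (σ : Equiv.Perm (Fin n × Fin p))
    (hσ : ∀ h, σ (TraceMap.rot p (Fin n) h) = TraceMap.rot p (Fin n) (σ h))
    (x : LabelledRootedMap p n) : LabelledRootedMap p n where
  map :=
    { α := σ.permCongr x.map.α
      invol := fun h => by simp [x.map.invol]
      no_fixed := fun h hh => by
        rw [Equiv.permCongr_apply, ← Equiv.eq_symm_apply] at hh
        exact x.map.no_fixed _ hh }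
  connected := by
    have : Nonempty (Fin n) := ⟨x.root.1⟩
    have hx := x.connected
    rw [TraceMap.connected_iff_halfEdges hp] at hx ⊢
    intro A h1 h2 hne
    have h3 := hx (σ ⁻¹' A) (fun h hh => ?_) (fun h hh => ?_) (hne.preimage σ.surjective)
    · rwa [Set.preimage_eq_univ_iff, σ.range_eq_univ, Set.univ_subset_iff] at h3
    · rw [Set.mem_preimage, hσ]
      exact h1 _ hh
    · have := h2 _ hh
      simpa [Equiv.permCongr_apply] using this
  root := σ x.root

open Classical in
-- The group of permutations respecting the rotation acts freely: the half-edges where two of them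
-- agree are stable under rotation and `α` when the images coincide, and contain the root, hence are
-- all of them. So every class has the size of the group.
theorem card_class (hp : 1 ≤ p) (x : LabelledRootedMap p n) :
    (Finset.univ.filter fun y : LabelledRootedMap p n =>
      (Quotient.mk _ y : RootedMap p n) = Quotient.mk _ x).card = n.factorial * p ^ n := by
  rw [← TraceMap.card_commute_rot hp n, ← Fintype.card_subtype]
  symm
  refine Fintype.card_of_bijective (f := fun σ => ⟨act hp σ.1 σ.2 x, ?_⟩) ⟨?_, ?_⟩
  · refine Quotient.sound (Setoid.symm ⟨σ.1, σ.2, fun h => ?_, rfl⟩)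
    simp [act]
  · rintro ⟨σ, hσ⟩ ⟨τ, hτ⟩ h
    have h1 : act hp σ hσ x = act hp τ hτ x := congrArg Subtype.val h
    have h2 : σ.permCongr x.map.α = τ.permCongr x.map.α :=
      congrArg (fun y : LabelledRootedMap p n => y.map.α) h1
    have h3 : σ x.root = τ x.root := congrArg (fun y : LabelledRootedMap p n => y.root) h1
    have h4 : ∀ h, σ h = τ h → σ (x.map.α h) = τ (x.map.α h) := by
      intro h hh
      have h5 := Equiv.congr_fun h2 (σ h)
      rw [Equiv.permCongr_apply, Equiv.permCongr_apply, Equiv.symm_apply_apply, hh,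
        Equiv.symm_apply_apply] at h5
      exact h5
    have : Nonempty (Fin n) := ⟨x.root.1⟩
    have h6 := (TraceMap.connected_iff_halfEdges hp).1 x.connected {h | σ h = τ h}
      (fun h hh => by
        have hh' : σ h = τ h := hh
        change σ _ = τ _
        rw [hσ, hτ, hh']) h4 ⟨x.root, h3⟩
    refine Subtype.ext (Equiv.ext fun h => ?_)
    have : h ∈ {h | σ h = τ h} := by rw [h6]; trivial
    exact this
  · rintro ⟨y, hy⟩
    obtain ⟨σ, h1, h2, h3⟩ := Quotient.exact hy.symm
    refine ⟨⟨σ, h1⟩, Subtype.ext ?_⟩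
    obtain ⟨b, hb, r⟩ := y
    simp only [act, mk.injEq]
    refine ⟨?_, h3⟩
    ext1; ext1 h
    change σ.permCongr x.map.α h = _
    rw [Equiv.permCongr_apply, h2, Equiv.apply_symm_apply]

end LabelledRootedMap

namespace TensorDistribution

variable {p : ℕ} {E : Type*} [AddCommGroup E] [Module ℝ E] (φ : TensorDistribution p E)

open Classical in
-- All classes have the same size, so summing the averages over the classes gives a plain sum over
-- labelled rooted maps, and each labelled map has `n * p` roots.
theorem moment_eq_sum (hp : 1 ≤ p) {n : ℕ} (hn : n ≠ 0) (T : E) :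
    φ.moment n T = ((n * p : ℕ) * ∑ b : TraceMap p (Fin n) with b.Connected,
      φ.val b (fun _ => T)) / (n.factorial * p ^ n : ℕ) := by
  rw [moment, if_neg hn]
  have h1 : ∀ b : RootedMap p n, φ.rootedVal b T =
      (∑ x : LabelledRootedMap p n with (Quotient.mk _ x : RootedMap p n) = b,
        φ.val x.map (fun _ => T)) / (n.factorial * p ^ n : ℕ) := by
    intro b
    induction b using Quotient.inductionOn with
    | _ x => rw [rootedVal, LabelledRootedMap.card_class hp]
  rw [Finset.sum_congr rfl fun b _ => h1 b, ← Finset.sum_div, Finset.sum_fiberwise]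
  congr 1
  let e : LabelledRootedMap p n ≃ {b : TraceMap p (Fin n) // b.Connected} × (Fin n × Fin p) :=
    { toFun := fun x => (⟨x.map, x.connected⟩, x.root)
      invFun := fun y => ⟨y.1.1, y.1.2, y.2⟩
      left_inv := fun _ => rfl
      right_inv := fun _ => rfl }
  rw [show ∑ x : LabelledRootedMap p n, φ.val x.map (fun _ => T) =
    ∑ y : {b : TraceMap p (Fin n) // b.Connected} × (Fin n × Fin p), φ.val y.1.1 (fun _ => T) from
    Fintype.sum_equiv e _ _ fun _ => rfl, Fintype.sum_prod_type]
  simp only [Finset.sum_const, Finset.card_univ, Fintype.card_prod, Fintype.card_fin, nsmul_eq_mul]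
  rw [← Finset.mul_sum]
  congr 1
  exact (Finset.sum_subtype (Finset.univ.filter fun b : TraceMap p (Fin n) => b.Connected)
    (by simp) fun b => φ.val b fun _ => T).symm

theorem moment_eq_cumulantPoly {q : ℕ} (hpq : p = 2 * q) (hp : 1 ≤ p) (n : ℕ) (T : E) :
    φ.moment n T = cumulantPoly p q (fun s => φ.freeCumulant s T) 1 n / (n.factorial * p ^ n : ℕ) := by
  classical
  rcases eq_or_ne n 0 with rfl | hn
  · simp [moment, cumulantPoly]
  · have := φ.sum_val_connected (V := Fin n) hpq T (by simpa using Nat.pos_of_ne_zero hn)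
    rw [Fintype.card_fin] at this
    rw [φ.moment_eq_sum hp hn, this]

end TensorDistribution

/-! ### Existence of the high order semicircular law -/

/-- The sequence `a` is the moment sequence of a probability measure on some interval `[0, R]`. -/
def IsBoundedMomentSequence (a : ℕ → ℝ) : Prop :=
  ∃ μ : Measure ℝ, IsProbabilityMeasure μ ∧ (∃ R, μ (Set.Icc 0 R)ᶜ = 0) ∧
    ∀ k, ∫ x, x ^ k ∂μ = a k

theorem IsBoundedMomentSequence.pow {c : ℝ} (hc : 0 ≤ c) :
    IsBoundedMomentSequence fun k => c ^ k := by
  refine ⟨Measure.dirac c, inferInstance, ⟨c, ?_⟩, fun k => by simp⟩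
  rw [Measure.dirac_apply' _ measurableSet_Icc.compl]
  simp [hc]

/-- The product of two independent variables has these moments. -/
theorem IsBoundedMomentSequence.mul {a b : ℕ → ℝ} (ha : IsBoundedMomentSequence a)
    (hb : IsBoundedMomentSequence b) : IsBoundedMomentSequence fun k => a k * b k := by
  obtain ⟨μ, hμ, ⟨R, hR⟩, hμa⟩ := ha
  obtain ⟨ν, hν, ⟨R', hR'⟩, hνb⟩ := hb
  have hm : Measurable fun z : ℝ × ℝ => z.1 * z.2 := by fun_prop
  refine ⟨(μ.prod ν).map fun z => z.1 * z.2, Measure.isProbabilityMeasure_map hm.aemeasurable,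
    ⟨R * R', ?_⟩, fun k => ?_⟩
  · rw [Measure.map_apply hm measurableSet_Icc.compl]
    refine measure_mono_null (t := (Set.Icc 0 R)ᶜ ×ˢ Set.univ ∪ Set.univ ×ˢ (Set.Icc 0 R')ᶜ) ?_ ?_
    · rintro ⟨x, y⟩ h
      by_contra h'
      simp only [Set.mem_union, Set.mem_prod, Set.mem_compl_iff, Set.mem_univ, and_true, true_and,
        not_or, not_not, Set.mem_Icc] at h'
      refine h ⟨mul_nonneg h'.1.1 h'.2.1, ?_⟩
      exact mul_le_mul h'.1.2 h'.2.2 h'.2.1 (h'.1.1.trans h'.1.2)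
    · rw [measure_union_null_iff, Measure.prod_prod, Measure.prod_prod, hR, hR']
      simp
  · rw [integral_map hm.aemeasurable (by fun_prop)]
    simp only [mul_pow]
    rw [integral_prod_mul (fun x : ℝ => x ^ k) (fun y : ℝ => y ^ k), hμa, hνb]

theorem IsBoundedMomentSequence.prod (r : ℕ) {a : ℕ → ℕ → ℝ}
    (ha : ∀ j < r, IsBoundedMomentSequence (a j)) :
    IsBoundedMomentSequence fun k => ∏ j ∈ Finset.range r, a j k := by
  induction r with
  | zero => simpa using IsBoundedMomentSequence.pow (zero_le_one' ℝ)
  | succ r ih =>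
    simp only [Finset.prod_range_succ]
    exact (ih fun j hj => ha j (by omega)).mul (ha r (by omega))

open ProbabilityTheory in
theorem integral_betaPDFReal {α β : ℝ} (hα : 0 < α) (hβ : 0 < β) :
    ∫ x, betaPDFReal α β x = 1 := by
  have h := lintegral_betaPDF_eq_one hα hβ
  have h0 : ∀ x, 0 ≤ betaPDFReal α β x := by
    intro x
    by_cases hx : 0 < x ∧ x < 1
    · exact (betaPDFReal_pos hx.1 hx.2 hα hβ).le
    · rw [betaPDFReal, if_neg hx]
  rw [integral_eq_lintegral_of_nonneg_ae (Eventually.of_forall h0) (by fun_prop)]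
  change (∫⁻ x, betaPDF α β x).toReal = 1
  rw [h, ENNReal.toReal_one]

open ProbabilityTheory in
/-- The moments of the beta distribution. -/
theorem IsBoundedMomentSequence.beta {α β : ℝ} (hα : 0 < α) (hβ : 0 < β) :
    IsBoundedMomentSequence fun k => ∏ i ∈ Finset.range k, ((α + i) / (α + β + i)) := by
  refine ⟨betaMeasure α β, isProbabilityMeasureBeta hα hβ, ⟨1, ?_⟩, fun k => ?_⟩
  · rw [betaMeasure, withDensity_apply _ measurableSet_Icc.compl,
      setLIntegral_eq_zero measurableSet_Icc.compl]
    intro x hx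
    rw [Set.mem_compl_iff, Set.mem_Icc, not_and_or, not_le, not_le] at hx
    rcases hx with hx | hx
    · exact betaPDF_eq_zero_of_nonpos hx.le
    · exact betaPDF_eq_zero_of_one_le hx.le
  · have h0 : ∀ x, 0 ≤ betaPDFReal α β x := by
      intro x
      by_cases hx : 0 < x ∧ x < 1
      · exact (betaPDFReal_pos hx.1 hx.2 hα hβ).le
      · rw [betaPDFReal, if_neg hx]
    have hk : 0 < α + k := by positivity
    have h1 : ∫ x, x ^ k ∂betaMeasure α β = ∫ x, betaPDFReal α β x * x ^ k := by
      rw [betaMeasure, integral_withDensity_eq_integral_toReal_smul]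
      · refine integral_congr_ae (Eventually.of_forall fun x => ?_)
        change (ENNReal.ofReal (betaPDFReal α β x)).toReal • x ^ k = _
        rw [ENNReal.toReal_ofReal (h0 x), smul_eq_mul]
      · exact (measurable_betaPDFReal α β).ennreal_ofReal
      · exact Eventually.of_forall fun x => ENNReal.ofReal_lt_top
    -- Multiplying by `x ^ k` only shifts the first parameter, so the moment is a quotient of beta
    -- functions.
    have h2 : ∀ x, betaPDFReal α β x * x ^ k =
        ProbabilityTheory.beta (α + k) β / ProbabilityTheory.beta α β *
          betaPDFReal (α + k) β x := by
      intro x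
      rw [betaPDFReal, betaPDFReal]
      split_ifs with hx
      · have e1 : x ^ (α + k - 1) = x ^ (α - 1) * x ^ k := by
          rw [← Real.rpow_natCast, ← Real.rpow_add hx.1]
          ring_nf
        have n1 := (beta_pos hk hβ).ne'
        have n2 := (beta_pos hα hβ).ne'
        rw [e1]
        field_simp
      · simp
    simp only [h1, h2]
    rw [integral_const_mul, integral_betaPDFReal hk hβ, mul_one]
    clear h0 h1 h2
    induction k with
    | zero => simp [(beta_pos hα hβ).ne']
    | succ k ih =>
      have hk' : 0 < α + k := by positivity
      rw [Finset.prod_range_succ, ← ih hk']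
      have e1 : Real.Gamma (α + (k + 1 : ℕ)) = (α + k) * Real.Gamma (α + k) := by
        rw [← Real.Gamma_add_one hk'.ne']
        push_cast
        ring_nf
      have e2 : Real.Gamma (α + (k + 1 : ℕ) + β) = (α + β + k) * Real.Gamma (α + k + β) := by
        have : α + k + β ≠ 0 := by positivity
        rw [show α + β + k = α + k + β by ring, ← Real.Gamma_add_one this]
        push_cast
        ring_nf
      have n1 := (beta_pos hα hβ).ne'
      have n2 : α + β + k ≠ 0 := by positivity
      have n3 : Real.Gamma (α + k + β) ≠ 0 := (Real.Gamma_pos_of_pos (by positivity)).ne'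
      rw [ProbabilityTheory.beta, ProbabilityTheory.beta.eq_def (α + k), e1, e2]
      field_simp

theorem factorial_add (m n : ℕ) :
    (m + n).factorial = m.factorial * ∏ j ∈ Finset.range n, (m + j + 1) := by
  induction n with
  | zero => simp
  | succ n ih => rw [Finset.prod_range_succ, ← add_assoc, Nat.factorial_succ, ih]; ring

theorem fussCatalan_eq (r k : ℕ) : fussCatalan (r + 1) k =
    ((r + 1) * k).factorial / (k.factorial * (r * k + 1).factorial) := by
  have h : k ≤ (r + 1) * k + 1 := by nlinarith
  rw [fussCatalan, Nat.cast_choose ℝ h, show (r + 1) * k + 1 - k = r * k + 1 by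
    rw [add_mul, one_mul]; omega, Nat.factorial_succ ((r + 1) * k)]
  have h1 : (((r + 1) * k + 1 : ℕ) : ℝ) ≠ 0 := by positivity
  have h2 : (k.factorial : ℝ) ≠ 0 := by positivity
  have h3 : ((r * k + 1).factorial : ℝ) ≠ 0 := by positivity
  rw [Nat.cast_mul]
  field_simp

theorem fussCatalan_succ (r k : ℕ) : fussCatalan (r + 1) (k + 1) = fussCatalan (r + 1) k *
    ((r + 1) * ∏ j ∈ Finset.range r, (((r + 1) * k + j + 1 : ℝ) / (r * k + j + 2))) := by
  have e1 : ((r + 1) * (k + 1)).factorial = ((r + 1) * k).factorial *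
      ((∏ j ∈ Finset.range r, ((r + 1) * k + j + 1)) * ((r + 1) * (k + 1))) := by
    rw [show (r + 1) * (k + 1) = (r + 1) * k + (r + 1) by ring, factorial_add,
      Finset.prod_range_succ]
    ring
  have e2 : (r * (k + 1) + 1).factorial = (r * k + 1).factorial *
      ∏ j ∈ Finset.range r, (r * k + j + 2) := by
    rw [show r * (k + 1) + 1 = r * k + 1 + r by ring, factorial_add]
    congr 1
    refine Finset.prod_congr rfl fun j _ => ?_
    ring
  rw [fussCatalan_eq, fussCatalan_eq, e1, e2, Nat.factorial_succ, Finset.prod_div_distrib]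
  push_cast
  have n1 : ∏ j ∈ Finset.range r, ((r : ℝ) * k + j + 2) ≠ 0 :=
    Finset.prod_ne_zero_iff.2 fun j _ => by positivity
  have n2 : (k.factorial : ℝ) ≠ 0 := by positivity
  have n3 : ((r * k + 1).factorial : ℝ) ≠ 0 := by positivity
  have n4 : (k + 1 : ℝ) ≠ 0 := by positivity
  field_simp

/-- The ratio of consecutive terms is a constant times `∏_j (α_j + k) / (α_j + β_j + k)` with `α_j =
(j + 1) / (r + 1)` and `α_j + β_j = (j + 2) / r`, which is the ratio for a product of `r`
independent beta variables. The leading coefficients give the constant `(r + 1) * ((r + 1) / r) ^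
r`. -/
theorem isBoundedMomentSequence_fussCatalan {p : ℕ} (hp : 2 ≤ p) :
    IsBoundedMomentSequence (fussCatalan p) := by
  obtain ⟨r, rfl⟩ := Nat.exists_eq_add_of_le' (show 1 ≤ p by omega)
  have hr : 0 < r := by omega
  have hr' : (0 : ℝ) < r := by exact_mod_cast hr
  have h1 : ∀ j < r, IsBoundedMomentSequence fun k => ∏ i ∈ Finset.range k,
      (((j + 1 : ℝ) / (r + 1) + i) / ((j + 1 : ℝ) / (r + 1) +
        ((j + 2 : ℝ) / r - (j + 1 : ℝ) / (r + 1)) + i)) := by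
    intro j _
    refine IsBoundedMomentSequence.beta (by positivity) ?_
    rw [sub_pos, div_lt_div_iff₀ (by positivity) hr']
    nlinarith [(Nat.cast_nonneg j : (0 : ℝ) ≤ j)]
  have h2 := (IsBoundedMomentSequence.pow (c := (r + 1) * ((r + 1) / r) ^ r)
    (by positivity)).mul (IsBoundedMomentSequence.prod r h1)
  convert h2 using 1
  ext k
  induction k with
  | zero => simp [fussCatalan]
  | succ k ih =>
    rw [fussCatalan_succ, ih]
    simp only [Finset.prod_range_succ, Finset.prod_mul_distrib, pow_succ _ k]
    have h3 : (∏ j ∈ Finset.range r, (((r + 1) * k + j + 1 : ℝ) / (r * k + j + 2))) =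
        ((r + 1 : ℝ) / r) ^ r * ∏ j ∈ Finset.range r, (((j + 1 : ℝ) / (r + 1) + k) /
          ((j + 1 : ℝ) / (r + 1) + ((j + 2 : ℝ) / r - (j + 1 : ℝ) / (r + 1)) + k)) := by
      rw [← Finset.card_range r, ← Finset.prod_const, Finset.card_range, ← Finset.prod_mul_distrib]
      refine Finset.prod_congr rfl fun j _ => ?_
      have n1 : (r * k + j + 2 : ℝ) ≠ 0 := by positivity
      have n2 : ((j + 2 : ℝ) / r + k) ≠ 0 := by positivity
      rw [add_sub_cancel]
      field_simp
      ring
    rw [h3]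
    ring

/-- The high order semicircular law exists: it is the law of `ε * √X` with a random sign `ε` and
an independent `X` whose moments are the Fuss-Catalan numbers. -/
theorem exists_isHighOrderSemicircular {p : ℕ} (hp : 2 ≤ p) :
    ∃ μ : Measure ℝ, IsHighOrderSemicircular p μ := by
  obtain ⟨μ, hμ, ⟨R, hR⟩, hm⟩ := isBoundedMomentSequence_fussCatalan hp
  let ρ : Measure Bool := (PMF.uniformOfFintype Bool).toMeasure
  let s : Bool → ℝ := fun e => if e then 1 else -1
  have hf : Measurable fun z : ℝ × Bool => √z.1 * s z.2 := by
    have : Measurable s := measurable_of_finite s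
    fun_prop
  -- The last factor is the `n`-th moment of the sign, `1` for even and `0` for odd `n`.
  have key : ∀ n, ∫ x, x ^ n ∂((μ.prod ρ).map fun z => √z.1 * s z.2) =
      (∫ x, √x ^ n ∂μ) * ((1 + (-1) ^ n) / 2) := by
    intro n
    rw [integral_map hf.aemeasurable (by fun_prop)]
    simp only [mul_pow]
    rw [integral_prod_mul (fun x : ℝ => √x ^ n) (fun e : Bool => s e ^ n), PMF.integral_eq_sum]
    simp only [PMF.uniformOfFintype_apply, Fintype.card_bool, Fintype.sum_bool, s]
    simp
    left
    ring
  refine ⟨(μ.prod ρ).map fun z => √z.1 * s z.2,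
    Measure.isProbabilityMeasure_map hf.aemeasurable, ⟨√R, ?_⟩, fun k => ?_, fun k => ?_⟩
  · rw [Measure.map_apply hf measurableSet_Icc.compl]
    refine measure_mono_null (t := (Set.Icc 0 R)ᶜ ×ˢ Set.univ) ?_ ?_
    · rintro ⟨x, e⟩ h
      refine ⟨fun hx => h ?_, trivial⟩
      have h1 : √x ≤ √R := Real.sqrt_le_sqrt hx.2
      have h2 := Real.sqrt_nonneg x
      cases e <;> simp only [s, Set.mem_Icc] <;> constructor <;> norm_num <;> linarith
    · rw [Measure.prod_prod, hR, zero_mul]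
  · rw [key, ← hm k]
    simp only [pow_mul, neg_one_sq, one_pow]
    norm_num
    refine integral_congr_ae ?_
    have : ∀ᵐ x ∂μ, x ∈ Set.Icc 0 R := hR
    filter_upwards [this] with x hx
    rw [Real.sq_sqrt hx.1]
  · rw [key, pow_succ (-1 : ℝ), pow_mul]
    simp

/-! ### Continuity and inversion of the recursion -/

theorem cumulantPoly_zero_right (p q : ℕ) (K : ℕ → ℝ) (a : ℕ) : cumulantPoly p q K a 0 = 1 := by
  induction a with
  | zero => simp [cumulantPoly]
  | succ a ih => simp [cumulantPoly, ih]

theorem tendsto_cumulantPoly (p q : ℕ) {K : ℕ → ℕ → ℝ} {L : ℕ → ℝ}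
    (h : ∀ s, Tendsto (fun k => K k (s + 1)) atTop (𝓝 (L (s + 1)))) (n : ℕ) : ∀ a,
    Tendsto (fun k => cumulantPoly p q (K k) a n) atTop (𝓝 (cumulantPoly p q L a n)) := by
  induction n using Nat.strong_induction_on with
  | _ n ihn =>
  intro a
  induction a with
  | zero => simp only [cumulantPoly]; exact tendsto_const_nhds
  | succ a iha =>
    simp only [cumulantPoly]
    refine iha.add (tendsto_finsetSum _ fun s _ => ?_)
    exact ((h s).mul ((ihn _ (by omega) _).const_mul _)).const_mul _

/-- Along the filter `⊤` the symbol `O` means a bound uniform in `i`. Only `K 1, …, K n` enter. -/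
theorem isBigO_cumulantPoly (p q : ℕ) {ι : Type*} {K : ι → ℕ → ℝ} (n : ℕ) : ∀ a,
    (∀ s < n, (fun i => K i (s + 1)) =O[⊤] fun _ => (1 : ℝ)) →
    (fun i => cumulantPoly p q (K i) a n) =O[⊤] fun _ => (1 : ℝ) := by
  induction n using Nat.strong_induction_on with
  | _ n ihn =>
  intro a h
  induction a with
  | zero => simp only [cumulantPoly]; exact Asymptotics.isBigO_const_const _ one_ne_zero _
  | succ a iha =>
    simp only [cumulantPoly]
    refine iha.add (Asymptotics.IsBigO.fun_sum fun s _ => ?_)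
    have h1 := (h s s.2).mul ((ihn (n - 1 - s) (by omega) (a + q * (s + 1))
      fun t ht => h t (by omega)).const_mul_left ((p * (s + 1) : ℕ) : ℝ))
    simp only [mul_one] at h1
    exact h1.const_mul_left _

/-- The top cumulant occurs only in the last term, linearly and with nonzero coefficient when `p ≠
0`, so the system is triangular and can be solved for the cumulants. -/
theorem cumulantPoly_one (p q : ℕ) (K : ℕ → ℝ) (m : ℕ) :
    cumulantPoly p q K 1 (m + 1) = (∑ s : Fin m, ((m + 1).choose (s + 1) : ℝ) *
      (K (s + 1) * ((p * (s + 1) : ℕ) * cumulantPoly p q K (q * (s + 1)) (m - s)))) +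
      (p * (m + 1) : ℕ) * K (m + 1) := by
  rw [show 1 = 0 + 1 from rfl, cumulantPoly, Fin.sum_univ_castSucc]
  simp [cumulantPoly, cumulantPoly_zero_right, mul_comm]

/-- Bounds on the moments yield bounds on the cumulants. -/
theorem isBigO_of_cumulantPoly {p q : ℕ} (hp : p ≠ 0) {ι : Type*} {K : ι → ℕ → ℝ}
    (h : ∀ n, (fun i => cumulantPoly p q (K i) 1 n) =O[⊤] fun _ => (1 : ℝ)) (m : ℕ) :
    (fun i => K i (m + 1)) =O[⊤] fun _ => (1 : ℝ) := by
  induction m using Nat.strong_induction_on with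
  | _ m ih =>
  have hpm : ((p * (m + 1) : ℕ) : ℝ) ≠ 0 := by positivity
  have h1 : (fun i => ∑ s : Fin m, ((m + 1).choose (s + 1) : ℝ) *
      (K i (s + 1) * ((p * (s + 1) : ℕ) * cumulantPoly p q (K i) (q * (s + 1)) (m - s))))
      =O[⊤] fun _ => (1 : ℝ) := by
    refine Asymptotics.IsBigO.fun_sum fun s _ => ?_
    have h2 := (ih s s.2).mul ((isBigO_cumulantPoly p q (K := K) (m - s) (q * (s + 1))
      fun t ht => ih t (by omega)).const_mul_left ((p * (s + 1) : ℕ) : ℝ))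
    simp only [mul_one] at h2
    exact h2.const_mul_left _
  have h3 := ((h (m + 1)).sub h1).const_mul_left ((p * (m + 1) : ℕ) : ℝ)⁻¹
  refine h3.congr_left fun i => ?_
  rw [cumulantPoly_one, add_sub_cancel_left, inv_mul_cancel_left₀ hpm]

/-! ### Raney numbers and the limiting moments -/

/-- The Raney numbers `a / (a + (r + 1) * k) * (a + (r + 1) * k).choose k`. -/
noncomputable def raney (r a : ℕ) : ℕ → ℝ
  | 0 => 1
  | k + 1 => a * (a + r * (k + 1) + k).factorial / ((k + 1).factorial * (a + r * (k + 1)).factorial)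

theorem raney_zero_left (r k : ℕ) : raney r 0 (k + 1) = 0 := by simp [raney]

/-- The coefficient form of `B^(a+1) = B^a + z * B^(a+r+1)`, where `B = 1 + z * B^(r+1)`. -/
theorem raney_succ (r a k : ℕ) : raney r (a + 1) (k + 1) = raney r a (k + 1) + raney r (a + (r + 1)) k := by
  have n3 : ((a + r * (k + 1)).factorial : ℝ) ≠ 0 := by positivity
  have n5 : (a + r * (k + 1) + 1 : ℝ) ≠ 0 := by positivity
  rcases k with _ | k
  · simp only [raney, zero_add, mul_one, add_zero]
    have e1 : a + 1 + r = a + r + 1 := by ring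
    rw [e1]
    have n1 : ((a + r + 1).factorial : ℝ) ≠ 0 := by positivity
    have n2 : ((a + r).factorial : ℝ) ≠ 0 := by positivity
    simp only [Nat.factorial_one]
    push_cast
    field_simp
  · simp only [raney]
    have e1 : a + 1 + r * (k + 1 + 1) + (k + 1) = (a + r * (k + 1 + 1) + (k + 1)) + 1 := by ring
    have e2 : a + (r + 1) + r * (k + 1) + k = a + r * (k + 1 + 1) + (k + 1) := by ring
    have e3 : a + 1 + r * (k + 1 + 1) = a + r * (k + 1 + 1) + 1 := by ring
    have e4 : a + (r + 1) + r * (k + 1) = a + r * (k + 1 + 1) + 1 := by ring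
    rw [e1, e2, e3, e4, Nat.factorial_succ (a + r * (k + 1 + 1) + (k + 1)),
      Nat.factorial_succ (a + r * (k + 1 + 1)), Nat.factorial_succ (k + 1)]
    push_cast at n3 n5 ⊢
    have n1 : ((k + 1).factorial : ℝ) ≠ 0 := by positivity
    have n2 : (k + 1 + 1 : ℝ) ≠ 0 := by positivity
    field_simp
    ring

theorem raney_one (r k : ℕ) : raney r 1 k = fussCatalan (r + 1) k := by
  rw [fussCatalan_eq]
  rcases k with _ | k
  · simp [raney]
  · rw [raney, show 1 + r * (k + 1) + k = (r + 1) * (k + 1) by ring, add_comm 1, Nat.cast_one,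
      one_mul]

/-- Only blocks of size `2` survive, with weight `(n + 2).choose 2 * p * (2 * p)`. As `2 * q = p`,
this becomes the Raney recursion with `r + 1 = p`. -/
theorem cumulantPoly_semicircular (p q : ℕ) (a n : ℕ) :
    cumulantPoly p q (fun s => if s = 2 then (p : ℝ) else 0) (a + 1) (n + 2) =
      cumulantPoly p q (fun s => if s = 2 then (p : ℝ) else 0) a (n + 2) +
      (n + 2) * (n + 1) * p ^ 2 *
        cumulantPoly p q (fun s => if s = 2 then (p : ℝ) else 0) (a + 2 * q) n := by
  rw [cumulantPoly]
  congr 1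
  rw [Fin.sum_univ_succ, Fin.sum_univ_succ, Finset.sum_eq_zero]
  · have h1 : (((n + 2).choose 2 : ℕ) : ℝ) = (n + 2) * (n + 1) / 2 := by
      rw [Nat.cast_choose_two]
      push_cast
      ring
    simp [h1, mul_comm q 2]
    ring
  · intro s _
    simp

theorem cumulantPoly_semicircular_eq {r q : ℕ} (hq : r + 1 = 2 * q) (k : ℕ) : ∀ a,
    cumulantPoly (r + 1) q (fun s => if s = 2 then ((r + 1 : ℕ) : ℝ) else 0) a (2 * k) =
      ((2 * k).factorial * (r + 1) ^ (2 * k) : ℕ) * raney r a k ∧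
    cumulantPoly (r + 1) q (fun s => if s = 2 then ((r + 1 : ℕ) : ℝ) else 0) a (2 * k + 1) = 0 := by
  induction k with
  | zero =>
    intro a
    refine ⟨by simp [cumulantPoly_zero_right, raney], ?_⟩
    induction a with
    | zero => simp [cumulantPoly]
    | succ a ih => simpa [cumulantPoly] using ih
  | succ k ihk =>
    intro a
    induction a with
    | zero => simp [cumulantPoly, raney_zero_left]
    | succ a iha =>
      rw [show 2 * (k + 1) + 1 = 2 * k + 1 + 2 by ring, show 2 * (k + 1) = 2 * k + 2 by ring] at iha ⊢
      rw [cumulantPoly_semicircular, cumulantPoly_semicircular, iha.1, iha.2, (ihk _).1, (ihk _).2,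
        raney_succ, ← hq]
      refine ⟨?_, by simp⟩
      rw [Nat.factorial_succ, Nat.factorial_succ]
      push_cast
      ring

theorem cumulantPoly_semicircular_integral {p q : ℕ} (hp : 1 ≤ p) (hpq : p = 2 * q) {μ : Measure ℝ}
    (hμ : IsHighOrderSemicircular p μ) (n : ℕ) :
    cumulantPoly p q (fun s => if s = 2 then (p : ℝ) else 0) 1 n / (n.factorial * p ^ n : ℕ) =
      ∫ x, x ^ n ∂μ := by
  obtain ⟨r, rfl⟩ := Nat.exists_eq_add_of_le' hp
  obtain ⟨k, rfl | rfl⟩ := Nat.even_or_odd' n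
  · rw [(cumulantPoly_semicircular_eq hpq k 1).1, hμ.integral_pow_even, raney_one,
      mul_div_cancel_left₀]
    positivity
  · rw [(cumulantPoly_semicircular_eq hpq k 1).2, hμ.integral_pow_odd, zero_div]

/-! ### Linearization and the limit theorem -/

namespace TensorDistribution

variable {p : ℕ} {E : Type*} [AddCommGroup E] [Module ℝ E] (φ : TensorDistribution p E)

/-- The free cumulants linearize sums of freely independent tensors. -/
theorem FreelyIndependent.freeCumulant_smul_sum {φ : TensorDistribution p E} {T : ℕ → E}
    (h : φ.FreelyIndependent T) (c : ℝ) (k s : ℕ) :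
    φ.freeCumulant (s + 1) (c • ∑ i ∈ Finset.range k, T i) =
      c ^ (s + 1) * ∑ i ∈ Finset.range k, φ.freeCumulant (s + 1) (T i) := by
  classical
  simp only [freeCumulant, connSum]
  rw [Finset.sum_comm, Finset.mul_sum]
  refine Finset.sum_congr rfl fun b hb => ?_
  have hb' : b.Connected := by simpa using hb
  rw [φ.cumulant_eq_sum (Fintype.piFinset fun _ : Fin (s + 1) => Finset.range k)
    (fun _ => c ^ (s + 1)) _ (fun r v => T (r v)), ← Finset.mul_sum]
  · congr 1
    symm
    -- Of all assignments of summands to the vertices only the constant ones survive, the others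
    -- giving mixed cumulants.
    refine Finset.sum_of_injOn (fun i _ => i) ?_ ?_ ?_ ?_
    · intro i _ j _ hij
      exact congrFun hij 0
    · intro i hi
      simpa using hi
    · intro r hr hr'
      apply h _ b hb'
      by_contra! hc
      refine hr' ⟨r 0, ?_, funext fun v => hc 0 v⟩
      rw [Fintype.mem_piFinset] at hr
      exact hr 0
    · intro i _
      rfl
  · intro b
    rw [(φ.val b).map_smul_univ (fun _ => c), (φ.val b).map_sum_finset (fun _ i => T i)
      (fun _ => Finset.range k)]
    simp [Finset.mul_sum]

end TensorDistribution

/-- Two of the `t + 3` factors turn the sum into a bounded mean; the remaining `t + 1 ≥ 1` factors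
tend to zero. -/
theorem tendsto_smul_sum {x : ℕ → ℝ} (hx : x =O[⊤] fun _ => (1 : ℝ)) (t : ℕ) :
    Tendsto (fun k : ℕ => (√k)⁻¹ ^ (t + 3) * ∑ i ∈ Finset.range k, x i) atTop (𝓝 0) := by
  obtain ⟨C, hC⟩ := Asymptotics.isBigO_top.1 hx
  have h0 : Tendsto (fun k : ℕ => (√k)⁻¹ ^ (t + 1)) atTop (𝓝 0) := by
    have h1 : Tendsto (fun k : ℕ => (√(k : ℝ))⁻¹) atTop (𝓝 0) :=
      tendsto_inv_atTop_zero.comp (Real.tendsto_sqrt_atTop.comp tendsto_natCast_atTop_atTop)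
    simpa using h1.pow (t + 1)
  have h2 : ∀ k : ℕ, |(k : ℝ)⁻¹ * ∑ i ∈ Finset.range k, x i| ≤ C := by
    intro k
    rcases Nat.eq_zero_or_pos k with rfl | hk
    · have := (norm_nonneg _).trans (hC 0)
      simpa using this
    · have hk' : (0 : ℝ) < k := by exact_mod_cast hk
      rw [abs_mul, abs_of_pos (inv_pos.2 hk'), inv_mul_le_iff₀ hk']
      calc |∑ i ∈ Finset.range k, x i| ≤ ∑ i ∈ Finset.range k, |x i| :=
            Finset.abs_sum_le_sum_abs _ _
        _ ≤ ∑ i ∈ Finset.range k, C := Finset.sum_le_sum fun i _ => by simpa using hC i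
        _ = k * C := by simp
  have h3 : ∀ k : ℕ, (√k)⁻¹ ^ (t + 3) * ∑ i ∈ Finset.range k, x i =
      (√k)⁻¹ ^ (t + 1) * ((k : ℝ)⁻¹ * ∑ i ∈ Finset.range k, x i) := by
    intro k
    have : (√(k : ℝ))⁻¹ ^ 2 = (k : ℝ)⁻¹ := by rw [inv_pow, Real.sq_sqrt (Nat.cast_nonneg k)]
    rw [← this]
    ring
  simp only [h3]
  exact h0.zero_mul_isBoundedUnder_le (isBoundedUnder_of ⟨C, h2⟩)

theorem mainTheorem5 {p : ℕ} (hp : Even p) (hp2 : 2 ≤ p)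
    {E : Type*} [AddCommGroup E] [Module ℝ E] (φ : TensorDistribution p E) (T : ℕ → E)
    (hfree : φ.FreelyIndependent T)
    (hm1 : ∀ i, φ.moment 1 (T i) = 0) (hm2 : ∀ i, φ.moment 2 (T i) = 1)
    (C : ∀ n, RootedMap p n → ℝ)
    (hC : ∀ (i n : ℕ) (b : RootedMap p n), |φ.rootedVal b (T i)| ≤ C n b) :
    ∃ μ : Measure ℝ, IsHighOrderSemicircular p μ ∧
      ∀ n : ℕ, Tendsto
        (fun k : ℕ => φ.moment n ((Real.sqrt k)⁻¹ • ∑ i ∈ Finset.range k, T i))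
        atTop (𝓝 (∫ x, x ^ n ∂μ)) := by
  obtain ⟨q, hpq⟩ := hp.exists_two_nsmul
  rw [smul_eq_mul] at hpq
  have hp1 : 1 ≤ p := by omega
  have hp0 : (p : ℝ) ≠ 0 := by positivity
  obtain ⟨μ, hμ⟩ := exists_isHighOrderSemicircular hp2
  refine ⟨μ, hμ, fun n => ?_⟩
  simp only [φ.moment_eq_cumulantPoly hpq hp1]
  rw [← cumulantPoly_semicircular_integral hp1 hpq hμ]
  refine (tendsto_cumulantPoly p q (fun s => ?_) n 1).div_const _
  have hK1 : ∀ i, φ.freeCumulant 1 (T i) = 0 := by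
    intro i
    have := hm1 i
    rw [φ.moment_eq_cumulantPoly hpq hp1, cumulantPoly_one] at this
    simpa [hp0] using this
  -- With `K_1 = 0` the second moment is `2 * p * K_2 / (2 * p ^ 2) = K_2 / p`.
  have hK2 : ∀ i, φ.freeCumulant 2 (T i) = p := by
    intro i
    have := hm2 i
    rw [φ.moment_eq_cumulantPoly hpq hp1, cumulantPoly_one] at this
    simp [hK1] at this
    field_simp at this
    linarith
  simp only [hfree.freeCumulant_smul_sum]
  rcases s with _ | _ | t
  · simp [hK1]
  · simp only [zero_add, Nat.reduceAdd, hK2, if_true]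
    refine tendsto_const_nhds.congr' ?_
    -- The term `k = 0` is an empty sum and has to be excluded.
    filter_upwards [eventually_ge_atTop 1] with k hk
    have hk' : (k : ℝ) ≠ 0 := by positivity
    rw [inv_pow, Real.sq_sqrt (Nat.cast_nonneg k)]
    simp [hk']
  · rw [if_neg (by omega)]
    refine tendsto_smul_sum ?_ t
    -- The hypothesis bounds moments, not cumulants: a moment is a finite sum of values bounded by
    -- `C`, and the triangular system transfers these bounds to the cumulants.
    refine isBigO_of_cumulantPoly (K := fun i s => φ.freeCumulant s (T i)) (q := q)
      (by omega : p ≠ 0) (fun m => ?_) (t + 2)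
    have h1 : (fun i => φ.moment m (T i)) =O[⊤] fun _ => (1 : ℝ) := by
      rcases eq_or_ne m 0 with rfl | hm
      · simp only [TensorDistribution.moment, if_true]
        exact Asymptotics.isBigO_refl _ _
      · refine Asymptotics.isBigO_top.2 ⟨∑ b : RootedMap p m, C m b, fun i => ?_⟩
        rw [TensorDistribution.moment, if_neg hm, norm_one, mul_one, Real.norm_eq_abs]
        exact (Finset.abs_sum_le_sum_abs _ _).trans (Finset.sum_le_sum fun b _ => hC i m b)
    simp only [φ.moment_eq_cumulantPoly hpq hp1] at h1
    have h2 := h1.const_mul_left ((m.factorial * p ^ m : ℕ) : ℝ)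
    have h3 : ((m.factorial * p ^ m : ℕ) : ℝ) ≠ 0 := by positivity
    simpa only [mul_div_cancel₀ _ h3] using h2
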